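/- Let $X$ be a compact metrizable space and let $\mathcal R\subseteq X\times X$ be an étale equivalence relation on $X$: an equivalence relation equipped with a second countable topology (not necessarily the relative one) that makes it an étale groupoid with product $(x,y)(y,z)=(x,z)$, inverse $(x,y)^{-1}=(y,x)$, range $r(x,y)=x$, domain $d(x,y)=y$, and unit space identified with $X$ (as a topological space) via $x\mapsto(x,x)$. Let $G$ be a countable discrete group and let $G\curvearrowright_\alpha(X,\mathcal R)$ be an automorphism system, that is, $G$ acts on $X$ so that each map $(x,y)\mapsto(gx,gy)$ is an automorphism of the étale groupoid $\mathcal R$. The semi-direct product groupoid is $$\mathcal R\rtimes_\alpha G=\{(x,g,y): g\in G,\ x,y\in X,\ (x,gy)\in\mathcal R\},\qquad (x,g,y)(y,h,v)=(x,gh,v),\quad (x,g,y)^{-1}=(y,g^{-1},x),$$ with the topology transferred from $\mathcal R\times G$ by the bijection $(x,g,y)\mapsto((x,gy),g)$; it is étale with unit space $X$. For an étale groupoid $\mathcal G$ with unit space $\mathcal G^{(0)}$, write $\mathcal G_u=d^{-1}(u)$; the $*$-algebra $C_c(\mathcal G)$ has the operations $(f*g)(\gamma)=\sum_{\gamma'\in\mathcal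 G_{d(\gamma)}}f(\gamma\gamma'^{-1})g(\gamma')$, $f^*(\gamma)=\overline{f(\gamma^{-1})}$, and $C_r^*(\mathcal G)$ is its completion in the norm $\|f\|_{red}=\sup_{u\in\mathcal G^{(0)}}\|\mathrm{Ind}_u(f)\|$, where $\mathrm{Ind}_u(f)$ is the operator $(\mathrm{Ind}_u(f)\varphi)(\gamma)=\sum_{\gamma'\in\mathcal G_u}f(\gamma\gamma'^{-1})\varphi(\gamma')$ on $\ell^2(\mathcal G_u)$. Let $\alpha$ also denote the action of $G$ on $C_r^*(\mathcal R)$ determined by $\alpha_g(f)(x,y)=f(g^{-1}x,g^{-1}y)$ for $f\in C_c(\mathcal R)$. The reduced crossed product $C_r^*(\mathcal R)\rtimes_{\alpha,r}G$ is the completion of the $*$-algebra $C_c(G,C_r^*(\mathcal R))$ of finitely supported functions, with operations $(\xi*\eta)(g)=\sum_{h}\xi(h)\alpha_h(\eta(h^{-1}g))$ and $\xi^*(g)=\alpha_g(\xi(g^{-1})^*)$, in the norm $\|\tilde\pi(\xi)\|$, where $\pi$ is a faithful representation of $C_r^*(\mathcal R)$ on a Hilbert space $H$ and $$(\tilde\pi(\xi)\varphi)(g)=\sum_{h\in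 G}\pi\big(\alpha_{g^{-1}}(\xi(h))\big)\varphi(h^{-1}g),\qquad \varphi\in\ell^2(G,H).$$ **Theorem.** For every choice of the faithful representation $\pi$ there is a $*$-isomorphism $$\Phi:\ C_r^*(\mathcal R\rtimes_\alpha G)\ \longrightarrow\ C_r^*(\mathcal R)\rtimes_{\alpha,r}G .$$ Moreover, if $G$ is abelian, then $\Phi$ can be chosen to satisfy $\Phi\circ\widehat{\rho_\alpha}_{\chi}=\widehat\alpha_\chi\circ\Phi$ for every $\chi$ in the dual group $\widehat G$. Here $\widehat{\rho_\alpha}$ is the action of $\widehat G$ on $C_r^*(\mathcal R\rtimes_\alpha G)$ induced by the canonical cocycle $\rho_\alpha(x,g,y)=g$, determined by $(\widehat{\rho_\alpha}_{\chi}f)(x,g,y)=\langle\chi,g\rangle f(x,g,y)$ for $f\in C_c(\mathcal R\rtimes_\alpha G)$, and $\widehat\alpha$ is the dual action, determined by $\widehat\alpha_\chi(\xi)(g)=\langle\chi,g\rangle\xi(g)$ for $\xi\in C_c(G,C_r^*(\mathcal R))$. In particular the $C^*$-dynamical systems $(C_r^*(\mathcal R\rtimes_\alpha G),\widehat G,\widehat{\rho_\alpha})$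 and $(C_r^*(\mathcal R)\rtimes_{\alpha,r}G,\widehat G,\widehat\alpha)$ are conjugate. -/

import Mathlib

open scoped ENNReal CompactlySupported InnerProductSpace

noncomputable section

namespace EtaleCrossed

set_option linter.unusedSectionVars false

/-! ### Operators on `ℓ²` spaces -/

/-- The Hilbert space `ℓ²(I, E)` of square summable `E`-valued functions on `I`. -/
abbrev Ell2 (I E : Type*) [NormedAddCommGroup E] : Type _ := lp (fun _ : I => E) 2

section Ell2

variable {I J E : Type*} [NormedAddCommGroup E] [InnerProductSpace ℂ E]

theorem memEll2_of_sum_sq_le (f : I → E) (C : ℝ)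
    (h : ∀ s : Finset I, ∑ i ∈ s, ‖f i‖ ^ 2 ≤ C) : Memℓp f 2 := by
  refine memℓp_gen' (C := C) fun s => ?_
  simpa using h s

theorem sum_sq_le_ell2 (φ : Ell2 I E) (s : Finset I) : ∑ i ∈ s, ‖φ i‖ ^ 2 ≤ ‖φ‖ ^ 2 := by
  have := lp.sum_rpow_le_norm_rpow (p := 2) (by simp) φ s
  simpa using this

theorem ell2_norm_le (φ : Ell2 I E) (C : ℝ) (hC : 0 ≤ C)
    (h : ∀ s : Finset I, ∑ i ∈ s, ‖φ i‖ ^ 2 ≤ C ^ 2) : ‖φ‖ ≤ C := by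
  refine lp.norm_le_of_forall_sum_le (p := 2) (by simp) hC fun s => ?_
  simpa using h s

/-- The coordinatewise action `(φ i)ᵢ ↦ (Tᵢ (φ i))ᵢ` of a uniformly bounded family of operators. -/
def diagOp (T : I → E →L[ℂ] E) (C : ℝ) (hC : 0 ≤ C) (hT : ∀ i, ‖T i‖ ≤ C) :
    Ell2 I E →L[ℂ] Ell2 I E :=
  have key : ∀ (φ : Ell2 I E) (s : Finset I), ∑ i ∈ s, ‖T i (φ i)‖ ^ 2 ≤ (C * ‖φ‖) ^ 2 := by
    intro φ s
    calc ∑ i ∈ s, ‖T i (φ i)‖ ^ 2 ≤ ∑ i ∈ s, C ^ 2 * ‖φ i‖ ^ 2 := by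
          refine Finset.sum_le_sum fun i _ => ?_
          rw [← mul_pow]
          gcongr
          exact (T i).le_of_opNorm_le (hT i) _
      _ = C ^ 2 * ∑ i ∈ s, ‖φ i‖ ^ 2 := by rw [Finset.mul_sum]
      _ ≤ (C * ‖φ‖) ^ 2 := by
          rw [mul_pow]
          gcongr
          exact sum_sq_le_ell2 φ s
  LinearMap.mkContinuous
    { toFun := fun φ => ⟨fun i => T i (φ i), memEll2_of_sum_sq_le _ _ (key φ)⟩
      map_add' := fun φ ψ => by ext i; exact map_add (T i) _ _
      map_smul' := fun c φ => by ext i; simp }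
    C fun φ => ell2_norm_le _ _ (by positivity) (key φ)

@[simp] theorem diagOp_apply (T : I → E →L[ℂ] E) (C : ℝ) (hC : 0 ≤ C) (hT : ∀ i, ‖T i‖ ≤ C)
    (φ : Ell2 I E) (i : I) : diagOp T C hC hT φ i = T i (φ i) := rfl

/-- The unitary `ℓ²(I, E) → ℓ²(J, E)`, `φ ↦ φ ∘ e⁻¹`, given by a bijection `e : I ≃ J`. -/
def reindexU (e : I ≃ J) : Ell2 I E ≃ₗᵢ[ℂ] Ell2 J E where
  toFun φ := ⟨fun j => φ (e.symm j), memEll2_of_sum_sq_le _ (‖φ‖ ^ 2) fun s => by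
    simpa using sum_sq_le_ell2 φ (s.map e.symm.toEmbedding)⟩
  invFun ψ := ⟨fun i => ψ (e i), memEll2_of_sum_sq_le _ (‖ψ‖ ^ 2) fun s => by
    simpa using sum_sq_le_ell2 ψ (s.map e.toEmbedding)⟩
  left_inv φ := by ext i; simp
  right_inv ψ := by ext i; simp
  map_add' φ ψ := rfl
  map_smul' c φ := by ext i; simp
  norm_map' φ := by
    refine le_antisymm (ell2_norm_le _ _ (norm_nonneg _) fun s => ?_)
      (ell2_norm_le _ _ (norm_nonneg _) fun s => ?_)
    · change ∑ j ∈ s, ‖φ (e.symm j)‖ ^ 2 ≤ _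
      simpa using sum_sq_le_ell2 φ (s.map e.symm.toEmbedding)
    · refine le_trans (le_of_eq ?_) (sum_sq_le_ell2 _ (s.map e.toEmbedding))
      rw [Finset.sum_map]
      change _ = ∑ i ∈ s, ‖φ (e.symm (e i))‖ ^ 2
      simp

@[simp] theorem reindexU_apply (e : I ≃ J) (φ : Ell2 I E) (j : J) :
    reindexU e φ j = φ (e.symm j) := rfl

@[simp] theorem reindexU_symm_apply (e : I ≃ J) (φ : Ell2 J E) (i : I) :
    (reindexU e).symm φ i = φ (e i) := rfl

/-- The unitary of `ℓ²(I, E)` multiplying the `i`-th coordinate by the unimodular number `c i`. -/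
def phaseU (c : I → Circle) : Ell2 I E ≃ₗᵢ[ℂ] Ell2 I E where
  toFun φ := ⟨fun i => (c i : ℂ) • φ i, memEll2_of_sum_sq_le _ (‖φ‖ ^ 2) fun s => by
    simpa [norm_smul, Circle.norm_coe] using sum_sq_le_ell2 φ s⟩
  invFun φ := ⟨fun i => ((c i)⁻¹ : ℂ) • φ i, memEll2_of_sum_sq_le _ (‖φ‖ ^ 2) fun s => by
    simpa [norm_smul, Circle.norm_coe] using sum_sq_le_ell2 φ s⟩
  left_inv φ := by ext i; simp
  right_inv φ := by ext i; simp
  map_add' φ ψ := by ext i; exact smul_add _ _ _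
  map_smul' a φ := by ext i; simp [smul_comm a]
  norm_map' φ := by
    refine le_antisymm (ell2_norm_le _ _ (norm_nonneg _) fun s => ?_)
      (ell2_norm_le _ _ (norm_nonneg _) fun s => ?_)
    · simpa [norm_smul, Circle.norm_coe] using sum_sq_le_ell2 φ s
    · refine le_trans (le_of_eq ?_) (sum_sq_le_ell2 _ s)
      simp [norm_smul, Circle.norm_coe]

@[simp] theorem phaseU_apply (c : I → Circle) (φ : Ell2 I E) (i : I) :
    phaseU c φ i = (c i : ℂ) • φ i := rfl

@[simp] theorem phaseU_symm_apply (c : I → Circle) (φ : Ell2 I E) (i : I) :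
    (phaseU c).symm φ i = ((c i)⁻¹ : ℂ) • φ i := rfl

/-- A scalar matrix indexed by `I` with entries bounded by `M` and at most `N` nonzero
entries in every row and in every column. -/
structure KernelBound (k : I → I → ℂ) (N : ℕ) (M : ℝ) : Prop where
  row : ∀ i, {j | k i j ≠ 0}.encard ≤ N
  col : ∀ j, {i | k i j ≠ 0}.encard ≤ N
  bound : ∀ i j, ‖k i j‖ ≤ M
  nonneg : 0 ≤ M

namespace KernelBound

variable {k : I → I → ℂ} {N : ℕ} {M : ℝ}

theorem finite_row (h : KernelBound k N M) (i : I) : {j | k i j ≠ 0}.Finite :=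
  Set.finite_of_encard_le_coe (h.row i)

theorem finite_col (h : KernelBound k N M) (j : I) : {i | k i j ≠ 0}.Finite :=
  Set.finite_of_encard_le_coe (h.col j)

theorem tsum_row (h : KernelBound k N M) (φ : I → ℂ) (i : I) :
    ∑' j, k i j * φ j = ∑ j ∈ (h.finite_row i).toFinset, k i j * φ j := by
  refine tsum_eq_sum fun j hj => ?_
  have : k i j = 0 := by simpa using hj
  simp [this]

theorem sum_sq_le (h : KernelBound k N M) (φ : Ell2 I ℂ) (s : Finset I) :
    ∑ i ∈ s, ‖∑' j, k i j * φ j‖ ^ 2 ≤ (N * M * ‖φ‖) ^ 2 := by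
  classical
  have hM := h.nonneg
  have h1 : ∀ i, ‖∑' j, k i j * φ j‖ ^ 2 ≤
      N * M ^ 2 * ∑ j ∈ (h.finite_row i).toFinset, ‖φ j‖ ^ 2 := by
    intro i
    have hcard : (((h.finite_row i).toFinset.card : ℕ) : ℝ) ≤ N := by
      have := h.row i
      rw [(h.finite_row i).encard_eq_coe_toFinset_card] at this
      exact_mod_cast this
    rw [h.tsum_row]
    calc ‖∑ j ∈ (h.finite_row i).toFinset, k i j * φ j‖ ^ 2
        ≤ (∑ j ∈ (h.finite_row i).toFinset, M * ‖φ j‖) ^ 2 := by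
          gcongr
          refine (norm_sum_le _ _).trans (Finset.sum_le_sum fun j _ => ?_)
          rw [norm_mul]
          gcongr
          exact h.bound i j
      _ ≤ (h.finite_row i).toFinset.card *
            ∑ j ∈ (h.finite_row i).toFinset, (M * ‖φ j‖) ^ 2 := sq_sum_le_card_mul_sum_sq
      _ ≤ N * ∑ j ∈ (h.finite_row i).toFinset, (M * ‖φ j‖) ^ 2 := by gcongr
      _ = _ := by simp only [mul_pow, ← Finset.mul_sum, mul_assoc]
  set t : Finset I := s.biUnion fun i => (h.finite_row i).toFinset
  have h2 : ∑ i ∈ s, ∑ j ∈ (h.finite_row i).toFinset, ‖φ j‖ ^ 2 ≤ ∑ j ∈ t, N * ‖φ j‖ ^ 2 := by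
    calc ∑ i ∈ s, ∑ j ∈ (h.finite_row i).toFinset, ‖φ j‖ ^ 2
        = ∑ j ∈ t, ∑ i ∈ s with j ∈ (h.finite_row i).toFinset, ‖φ j‖ ^ 2 := by
          refine Finset.sum_comm' fun i j => ?_
          simp only [t, Finset.mem_filter, Finset.mem_biUnion]
          constructor
          · rintro ⟨a, b⟩
            exact ⟨⟨a, b⟩, i, a, b⟩
          · rintro ⟨⟨a, b⟩, _⟩
            exact ⟨a, b⟩
      _ ≤ _ := by
          refine Finset.sum_le_sum fun j _ => ?_
          rw [Finset.sum_const, nsmul_eq_mul]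
          gcongr
          have := h.col j
          rw [(h.finite_col j).encard_eq_coe_toFinset_card] at this
          have h3 : (h.finite_col j).toFinset.card ≤ N := by exact_mod_cast this
          refine le_trans (Finset.card_le_card fun i hi => ?_) h3
          simpa using (Finset.mem_filter.1 hi).2
  calc ∑ i ∈ s, ‖∑' j, k i j * φ j‖ ^ 2
      ≤ ∑ i ∈ s, N * M ^ 2 * ∑ j ∈ (h.finite_row i).toFinset, ‖φ j‖ ^ 2 :=
        Finset.sum_le_sum fun i _ => h1 i
    _ = N * M ^ 2 * ∑ i ∈ s, ∑ j ∈ (h.finite_row i).toFinset, ‖φ j‖ ^ 2 := by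
        rw [Finset.mul_sum]
    _ ≤ N * M ^ 2 * ∑ j ∈ t, N * ‖φ j‖ ^ 2 := by gcongr
    _ = N * M ^ 2 * N * ∑ j ∈ t, ‖φ j‖ ^ 2 := by rw [← Finset.mul_sum]; ring
    _ ≤ N * M ^ 2 * N * ‖φ‖ ^ 2 := by
        gcongr
        exact sum_sq_le_ell2 φ t
    _ = _ := by ring

/-- The bounded operator `(k φ) i = ∑ⱼ k i j * φ j` on `ℓ²(I)` given by the matrix `k`. -/
def op (h : KernelBound k N M) : Ell2 I ℂ →L[ℂ] Ell2 I ℂ :=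
  LinearMap.mkContinuous
    { toFun := fun φ => ⟨fun i => ∑' j, k i j * φ j, memEll2_of_sum_sq_le _ _ (h.sum_sq_le φ)⟩
      map_add' := fun φ ψ => by
        ext i
        refine (h.tsum_row _ i).trans (Eq.trans ?_
          (congrArg₂ (· + ·) (h.tsum_row φ i) (h.tsum_row ψ i)).symm)
        simp only [← Finset.sum_add_distrib, ← mul_add]
        rfl
      map_smul' := fun c φ => by
        ext i
        simp only [lp.coeFn_smul, Pi.smul_apply, smul_eq_mul, RingHom.id_apply,
          h.tsum_row (fun j => φ j) i, h.tsum_row (fun j => c * φ j) i, Finset.mul_sum]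
        exact Finset.sum_congr rfl fun j _ => by ring }
    (N * M) fun φ => ell2_norm_le _ _ (by have := h.nonneg; positivity) (h.sum_sq_le φ)

theorem op_apply (h : KernelBound k N M) (φ : Ell2 I ℂ) (i : I) :
    h.op φ i = ∑' j, k i j * φ j := rfl

theorem norm_op_le (h : KernelBound k N M) : ‖h.op‖ ≤ N * M :=
  LinearMap.mkContinuous_norm_le _ (by have := h.nonneg; positivity) _

end KernelBound

/-- The matrix coefficient of an operator on `ℓ²(I)` at `(i, j)`. -/
def entry (T : Ell2 I ℂ →L[ℂ] Ell2 I ℂ) (i j : I) : ℂ := by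
  classical exact T (lp.single 2 j (1 : ℂ)) i

theorem ext_entry {T S : Ell2 I ℂ →L[ℂ] Ell2 I ℂ} (h : ∀ i j, entry T i j = entry S i j) :
    T = S := by
  classical
  refine lp.ext_continuousLinearMap (by simp) fun j => ?_
  ext i
  simpa [entry] using h i j

theorem entry_op {k : I → I → ℂ} {N : ℕ} {M : ℝ} (h : KernelBound k N M) (i j : I) :
    entry h.op i j = k i j := by
  classical
  rw [entry, h.op_apply, tsum_eq_single j]
  · simp
  · intro l hl
    simp [hl]

theorem entry_star (T : Ell2 I ℂ →L[ℂ] Ell2 I ℂ) (i j : I) :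
    entry (star T) i j = star (entry T j i) := by
  classical
  have h1 : ⟪lp.single 2 i (1 : ℂ), star T (lp.single 2 j (1 : ℂ))⟫_ℂ =
      ⟪T (lp.single 2 i (1 : ℂ)), lp.single 2 j (1 : ℂ)⟫_ℂ := by
    rw [ContinuousLinearMap.star_eq_adjoint, ContinuousLinearMap.adjoint_inner_right]
  rw [lp.inner_single_left, lp.inner_single_right] at h1
  simpa [entry] using h1

theorem entry_mul_op (T : Ell2 I ℂ →L[ℂ] Ell2 I ℂ) {k : I → I → ℂ} {N : ℕ} {M : ℝ}
    (h : KernelBound k N M) (i j : I) :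
    entry (h.op * T) i j = ∑' l, k i l * entry T l j := by
  classical
  rfl

theorem entry_reindexU (e : I ≃ J) (T : Ell2 I ℂ →L[ℂ] Ell2 I ℂ) (i j : J) :
    entry ((reindexU e).conjStarAlgEquiv T) i j = entry T (e.symm i) (e.symm j) := by
  classical
  have : (reindexU e).symm (lp.single 2 j (1 : ℂ)) = lp.single 2 (e.symm j) (1 : ℂ) := by
    ext l
    rw [reindexU_symm_apply, lp.single_apply, lp.single_apply]
    by_cases hl : l = e.symm j
    · subst hl; simp
    · have : e l ≠ j := fun h => hl (by simp [← h])
      simp [hl, this]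
  rw [entry, LinearIsometryEquiv.conjStarAlgEquiv_apply_apply, this, reindexU_apply, entry]

theorem entry_phaseU (c : I → Circle) (T : Ell2 I ℂ →L[ℂ] Ell2 I ℂ) (i j : I) :
    entry ((phaseU c).conjStarAlgEquiv T) i j = (c i : ℂ) * entry T i j * ((c j)⁻¹ : ℂ) := by
  classical
  have : (phaseU c).symm (lp.single 2 j (1 : ℂ)) = ((c j)⁻¹ : ℂ) • lp.single 2 j (1 : ℂ) := by
    ext l
    rw [phaseU_symm_apply, lp.coeFn_smul, Pi.smul_apply]
    by_cases hl : l = j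
    · subst hl; rfl
    · rw [lp.single_apply_ne _ _ _ hl]; simp
  rw [entry, LinearIsometryEquiv.conjStarAlgEquiv_apply_apply, this, phaseU_apply, map_smul, entry]
  simp
  ring

end Ell2

/-! ### Actions on C*-algebras -/

section Actions

variable {P K : Type*} [NonUnitalCStarAlgebra P] [Group K]

/-- A family of `*`-endomorphisms satisfying the group laws is an action by `*`-automorphisms. -/
def actionOfHoms (Θ : K → P →⋆ₙₐ[ℂ] P) (h1 : ∀ a, Θ 1 a = a)
    (hmul : ∀ g h a, Θ (g * h) a = Θ g (Θ h a)) : K →* (P ≃⋆ₐ[ℂ] P) where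
  toFun g :=
    { toFun := Θ g
      invFun := Θ g⁻¹
      left_inv := fun a => by rw [← hmul, inv_mul_cancel, h1]
      right_inv := fun a => by rw [← hmul, mul_inv_cancel, h1]
      map_mul' := map_mul (Θ g)
      map_add' := map_add (Θ g)
      map_star' := map_star (Θ g)
      map_smul' := map_smul (Θ g) }
  map_one' := by ext a; exact h1 a
  map_mul' g h := by ext a; exact hmul g h a

@[simp] theorem actionOfHoms_apply (Θ : K → P →⋆ₙₐ[ℂ] P) (h1 : ∀ a, Θ 1 a = a)
    (hmul : ∀ g h a, Θ (g * h) a = Θ g (Θ h a)) (g : K) (a : P) :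
    actionOfHoms Θ h1 hmul g a = Θ g a := rfl

theorem mem_closure_of_map (Θ : P ≃⋆ₐ[ℂ] P) (S : NonUnitalStarSubalgebra ℂ P)
    (h : ∀ a ∈ S, Θ a ∈ S) {a : P} (ha : a ∈ S.topologicalClosure) :
    Θ a ∈ S.topologicalClosure :=
  map_mem_closure (StarAlgEquiv.isometry Θ).continuous ha h

/-- An action on a C*-algebra that preserves a `*`-subalgebra restricts to its norm closure. -/
def restrictAction (Θ : K →* (P ≃⋆ₐ[ℂ] P)) (S : NonUnitalStarSubalgebra ℂ P)
    (h : ∀ g, ∀ a ∈ S, Θ g a ∈ S) :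
    K →* (S.topologicalClosure ≃⋆ₐ[ℂ] S.topologicalClosure) where
  toFun g :=
    { toFun := fun a => ⟨Θ g a, mem_closure_of_map (Θ g) S (h g) a.2⟩
      invFun := fun a => ⟨Θ g⁻¹ a, mem_closure_of_map (Θ g⁻¹) S (h g⁻¹) a.2⟩
      left_inv := fun a => Subtype.ext <| by
        change Θ g⁻¹ (Θ g a) = a
        rw [← StarAlgEquiv.mul_apply, ← map_mul]; simp
      right_inv := fun a => Subtype.ext <| by
        change Θ g (Θ g⁻¹ a) = a
        rw [← StarAlgEquiv.mul_apply, ← map_mul]; simp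
      map_mul' := fun a b => Subtype.ext <| map_mul (Θ g) (a : P) b
      map_add' := fun a b => Subtype.ext <| map_add (Θ g) (a : P) b
      map_star' := fun a => Subtype.ext <| map_star (Θ g) (a : P)
      map_smul' := fun c a => Subtype.ext <| map_smul (Θ g) c (a : P) }
  map_one' := by ext a; simp
  map_mul' g h := by ext a; simp

@[simp] theorem coe_restrictAction (Θ : K →* (P ≃⋆ₐ[ℂ] P)) (S : NonUnitalStarSubalgebra ℂ P)
    (h : ∀ g, ∀ a ∈ S, Θ g a ∈ S) (g : K) (a : S.topologicalClosure) :
    (restrictAction Θ S h g a : P) = Θ g a := rfl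

end Actions

/-! ### Étale groupoids and their reduced C*-algebras -/

/-- A second countable, locally compact, Hausdorff étale groupoid with space of arrows `Γ` and
unit space `X`; a unit `x : X` is identified with the arrow `unit x`. The range and domain maps
are `r` and `d`, and the product `mul a b` is defined when `d a = r b`. -/
structure EtaleGroupoid (X Γ : Type*) [TopologicalSpace X] [TopologicalSpace Γ] where
  r : Γ → X
  d : Γ → X
  unit : X → Γ
  inv : Γ → Γ
  mul : ∀ a b : Γ, d a = r b → Γ
  r_unit : ∀ x, r (unit x) = x
  d_unit : ∀ x, d (unit x) = x
  r_inv : ∀ a, r (inv a) = d a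
  d_inv : ∀ a, d (inv a) = r a
  r_mul : ∀ a b h, r (mul a b h) = r a
  d_mul : ∀ a b h, d (mul a b h) = d b
  mul_assoc : ∀ a b c hab hbc h₁ h₂, mul (mul a b hab) c h₁ = mul a (mul b c hbc) h₂
  unit_mul : ∀ a h, mul (unit (r a)) a h = a
  mul_unit : ∀ a h, mul a (unit (d a)) h = a
  inv_mul : ∀ a h, mul (inv a) a h = unit (d a)
  mul_inv : ∀ a h, mul a (inv a) h = unit (r a)
  continuous_unit : Continuous unit
  continuous_inv : Continuous inv
  continuous_mul : Continuous fun p : {p : Γ × Γ // d p.1 = r p.2} => mul p.1.1 p.1.2 p.2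
  isLocalHomeomorph_r : IsLocalHomeomorph r
  isLocalHomeomorph_d : IsLocalHomeomorph d
  t2Space : T2Space Γ
  locallyCompactSpace : LocallyCompactSpace Γ
  secondCountableTopology : SecondCountableTopology Γ

theorem exists_fiber_bound {X Γ : Type*} [TopologicalSpace X] [TopologicalSpace Γ] {p : Γ → X}
    (hp : IsLocalHomeomorph p) {C : Set Γ} (hC : IsCompact C) :
    ∃ N : ℕ, ∀ x, (C ∩ p ⁻¹' {x}).encard ≤ N := by
  choose e he hpe using hp
  obtain ⟨t, -, htC⟩ := hC.elim_nhds_subcover (fun a => (e a).source)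
    fun a _ => (e a).open_source.mem_nhds (he a)
  refine ⟨t.card, fun x => ?_⟩
  have hex : ∀ y : Γ, ∃ a : Γ, y ∈ C → a ∈ t ∧ y ∈ (e a).source := by
    intro y
    by_cases hy : y ∈ C
    · obtain ⟨a, ha, hya⟩ := Set.mem_iUnion₂.1 (htC hy)
      exact ⟨a, fun _ => ⟨ha, hya⟩⟩
    · exact ⟨y, fun h => absurd h hy⟩
  choose q hq using hex
  rw [← Set.encard_coe_eq_coe_finsetCard]
  refine Set.encard_le_encard_of_injOn (f := q) (fun y hy => (hq y hy.1).1) ?_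
  intro y hy z hz hyz
  have h1 := (hq y hy.1).2
  have h2 := (hq z hz.1).2
  rw [← hyz] at h2
  refine (e (q y)).injOn h1 h2 ?_
  have h3 : p y = p z := by rw [hy.2, hz.2]
  rw [← congrFun (hpe (q y)) y, ← congrFun (hpe (q y)) z]
  exact h3

namespace EtaleGroupoid

section Groupoid

variable {X Γ : Type*} [TopologicalSpace X] [TopologicalSpace Γ] (𝒢 : EtaleGroupoid X Γ)

theorem mul_congr {a b a' b' : Γ} (ha : a = a') (hb : b = b') (h : 𝒢.d a = 𝒢.r b)
    (h' : 𝒢.d a' = 𝒢.r b') : 𝒢.mul a b h = 𝒢.mul a' b' h' := by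
  subst ha; subst hb; rfl

/-- The product `a b⁻¹`, defined when `d a = d b`. -/
def div (a b : Γ) (h : 𝒢.d a = 𝒢.d b) : Γ := 𝒢.mul a (𝒢.inv b) (h.trans (𝒢.r_inv b).symm)

theorem r_div (a b : Γ) (h : 𝒢.d a = 𝒢.d b) : 𝒢.r (𝒢.div a b h) = 𝒢.r a := 𝒢.r_mul _ _ _

theorem d_div (a b : Γ) (h : 𝒢.d a = 𝒢.d b) : 𝒢.d (𝒢.div a b h) = 𝒢.r b :=
  (𝒢.d_mul _ _ _).trans (𝒢.d_inv b)

theorem div_congr {a b a' b' : Γ} (ha : a = a') (hb : b = b') (h : 𝒢.d a = 𝒢.d b)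
    (h' : 𝒢.d a' = 𝒢.d b') : 𝒢.div a b h = 𝒢.div a' b' h' := by
  subst ha; subst hb; rfl

theorem div_mul_cancel (a b : Γ) (h : 𝒢.d a = 𝒢.d b) :
    𝒢.mul (𝒢.div a b h) b (𝒢.d_div a b h) = a := by
  refine (𝒢.mul_assoc a (𝒢.inv b) b _ (𝒢.d_inv b) _ (by rw [𝒢.r_mul, 𝒢.r_inv, h])).trans ?_
  rw [𝒢.mul_congr rfl ((𝒢.inv_mul b _).trans (by rw [h])) _ (𝒢.r_unit (𝒢.d a)).symm, 𝒢.mul_unit]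

theorem mul_div_cancel (a b : Γ) (h : 𝒢.d a = 𝒢.r b) :
    𝒢.div (𝒢.mul a b h) b (𝒢.d_mul a b h) = a := by
  unfold div
  rw [𝒢.mul_assoc a b (𝒢.inv b) h (𝒢.r_inv b).symm _ (by rw [𝒢.r_mul, h])]
  rw [𝒢.mul_congr rfl ((𝒢.mul_inv b _).trans (by rw [h])) _ (𝒢.r_unit (𝒢.d a)).symm, 𝒢.mul_unit]

theorem div_mul_div (a b c : Γ) (hab : 𝒢.d a = 𝒢.d b) (hbc : 𝒢.d b = 𝒢.d c)
    (h : 𝒢.d (𝒢.div a b hab) = 𝒢.r (𝒢.div b c hbc)) :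
    𝒢.mul (𝒢.div a b hab) (𝒢.div b c hbc) h = 𝒢.div a c (hab.trans hbc) := by
  have h1 : 𝒢.d b = 𝒢.r (𝒢.inv c) := hbc.trans (𝒢.r_inv c).symm
  have h2 := 𝒢.mul_assoc (𝒢.div a b hab) b (𝒢.inv c) (𝒢.d_div a b hab) h1
    ((𝒢.d_mul _ _ _).trans h1) h
  refine h2.symm.trans ?_
  exact 𝒢.mul_congr (𝒢.div_mul_cancel a b hab) rfl _ _

theorem div_div_div (a b c : Γ) (hac : 𝒢.d a = 𝒢.d c) (hbc : 𝒢.d b = 𝒢.d c)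
    (h : 𝒢.d (𝒢.div a c hac) = 𝒢.d (𝒢.div b c hbc)) :
    𝒢.div (𝒢.div a c hac) (𝒢.div b c hbc) h = 𝒢.div a b (hac.trans hbc.symm) := by
  have hab := hac.trans hbc.symm
  have h1 : 𝒢.d (𝒢.div a b hab) = 𝒢.r (𝒢.div b c hbc) := by rw [𝒢.d_div, 𝒢.r_div]
  have h2 := 𝒢.mul_div_cancel (𝒢.div a b hab) (𝒢.div b c hbc) h1
  rw [← h2]
  exact 𝒢.div_congr (𝒢.div_mul_div a b c hab hbc h1).symm rfl _ _

theorem div_self (a : Γ) : 𝒢.div a a rfl = 𝒢.unit (𝒢.r a) := 𝒢.mul_inv a _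

theorem unit_div (a b : Γ) (h : 𝒢.d a = 𝒢.d b) (h' : 𝒢.d (𝒢.unit (𝒢.r b)) = 𝒢.d (𝒢.div a b h)) :
    𝒢.div (𝒢.unit (𝒢.r b)) (𝒢.div a b h) h' = 𝒢.div b a h.symm := by
  have h2 := 𝒢.div_div_div b a b rfl h ((𝒢.d_div _ _ _).trans (𝒢.d_div _ _ _).symm)
  rw [← h2]
  exact 𝒢.div_congr (𝒢.div_self b).symm rfl _ _

theorem inv_div (a b : Γ) (h : 𝒢.d a = 𝒢.d b) : 𝒢.inv (𝒢.div a b h) = 𝒢.div b a h.symm := by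
  have h' : 𝒢.d (𝒢.unit (𝒢.r b)) = 𝒢.d (𝒢.div a b h) := by rw [𝒢.d_unit, 𝒢.d_div]
  rw [← 𝒢.unit_div a b h h']
  have h3 : 𝒢.r b = 𝒢.r (𝒢.inv (𝒢.div a b h)) := by rw [𝒢.r_inv, 𝒢.d_div]
  unfold div at h3 ⊢
  rw [𝒢.mul_congr (congrArg 𝒢.unit h3) rfl _ (𝒢.d_unit _), 𝒢.unit_mul]

theorem inv_inv (a : Γ) : 𝒢.inv (𝒢.inv a) = a := by
  have h : 𝒢.d (𝒢.unit (𝒢.d a)) = 𝒢.d a := 𝒢.d_unit _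
  have h1 : 𝒢.div (𝒢.unit (𝒢.d a)) a h = 𝒢.inv a := by
    unfold div
    rw [𝒢.mul_congr (congrArg 𝒢.unit (𝒢.r_inv a).symm) rfl _ (𝒢.d_unit _), 𝒢.unit_mul]
  rw [← h1, 𝒢.inv_div]
  unfold div
  have h2 : 𝒢.inv (𝒢.unit (𝒢.d a)) = 𝒢.unit (𝒢.d a) := by
    have h4 := 𝒢.mul_inv (𝒢.unit (𝒢.d a)) (𝒢.r_inv _).symm
    rw [𝒢.r_unit] at h4
    refine (𝒢.unit_mul (𝒢.inv (𝒢.unit (𝒢.d a))) (𝒢.d_unit _)).symm.trans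
      ((𝒢.mul_congr ?_ rfl _ _).trans h4)
    rw [𝒢.r_inv, 𝒢.d_unit]
  rw [𝒢.mul_congr rfl h2 _ (𝒢.r_unit _).symm, 𝒢.mul_unit]

theorem div_left_injective {a b c : Γ} (hb : 𝒢.d a = 𝒢.d b) (hc : 𝒢.d a = 𝒢.d c)
    (h : 𝒢.div a b hb = 𝒢.div a c hc) : b = c := by
  have h1 := congrArg 𝒢.inv h
  rw [𝒢.inv_div, 𝒢.inv_div] at h1
  rw [← 𝒢.div_mul_cancel b a hb.symm, ← 𝒢.div_mul_cancel c a hc.symm]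
  exact 𝒢.mul_congr h1 rfl _ _

theorem div_right_injective {a b c : Γ} (ha : 𝒢.d a = 𝒢.d c) (hb : 𝒢.d b = 𝒢.d c)
    (h : 𝒢.div a c ha = 𝒢.div b c hb) : a = b := by
  rw [← 𝒢.div_mul_cancel a c ha, ← 𝒢.div_mul_cancel b c hb]
  exact 𝒢.mul_congr h rfl _ _

theorem t2Space_units (𝒢 : EtaleGroupoid X Γ) : T2Space X := by
  have := 𝒢.t2Space
  exact T2Space.of_injective_continuous
    (Function.LeftInverse.injective 𝒢.r_unit) 𝒢.continuous_unit

theorem continuous_div :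
    Continuous fun p : {p : Γ × Γ // 𝒢.d p.1 = 𝒢.d p.2} => 𝒢.div p.1.1 p.1.2 p.2 := by
  refine 𝒢.continuous_mul.comp (f := fun p : {p : Γ × Γ // 𝒢.d p.1 = 𝒢.d p.2} =>
    (⟨(p.1.1, 𝒢.inv p.1.2), p.2.trans (𝒢.r_inv _).symm⟩ :
      {p : Γ × Γ // 𝒢.d p.1 = 𝒢.r p.2})) ?_
  refine Continuous.subtype_mk ?_ _
  exact (continuous_fst.comp continuous_subtype_val).prodMk
    (𝒢.continuous_inv.comp (continuous_snd.comp continuous_subtype_val))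

/-- The inversion as a homeomorphism. -/
def invHomeo : Γ ≃ₜ Γ where
  toFun := 𝒢.inv
  invFun := 𝒢.inv
  left_inv := 𝒢.inv_inv
  right_inv := 𝒢.inv_inv
  continuous_toFun := 𝒢.continuous_inv
  continuous_invFun := 𝒢.continuous_inv

/-- The set `𝒢_u = d⁻¹(u)` of arrows with domain `u`. -/
abbrev Fiber (u : X) : Type _ := {γ : Γ // 𝒢.d γ = u}

/-! #### The `*`-algebra `C_c(𝒢)` -/

/-- The convolution `(f * g)(γ) = ∑_{β ∈ 𝒢_{d(γ)}} f(γ β⁻¹) g(β)`, a finite sum. -/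
def convFun (f g : Γ → ℂ) (γ : Γ) : ℂ :=
  ∑' β : 𝒢.Fiber (𝒢.d γ), f (𝒢.div γ β.1 β.2.symm) * g β.1

theorem finite_fiber {g : Γ → ℂ} (hg : HasCompactSupport g) (u : X) :
    {β : 𝒢.Fiber u | g β.1 ≠ 0}.Finite := by
  obtain ⟨N, hN⟩ := exists_fiber_bound 𝒢.isLocalHomeomorph_d hg
  have h1 : (tsupport g ∩ 𝒢.d ⁻¹' {u}).Finite := Set.finite_of_encard_le_coe (hN u)
  refine Set.Finite.of_finite_image (f := Subtype.val) (h1.subset ?_)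
    Subtype.val_injective.injOn
  rintro _ ⟨β, hβ, rfl⟩
  exact ⟨subset_tsupport g hβ, β.2⟩

theorem summable_conv (f : Γ → ℂ) {g : Γ → ℂ} (hg : HasCompactSupport g) (γ : Γ) :
    Summable fun β : 𝒢.Fiber (𝒢.d γ) => f (𝒢.div γ β.1 β.2.symm) * g β.1 := by
  refine summable_of_hasFiniteSupport ((𝒢.finite_fiber hg (𝒢.d γ)).subset fun β hβ h0 => ?_)
  simp [h0] at hβ

theorem convFun_sum (f : Γ → ℂ) {n : ℕ} (g : Fin n → Γ → ℂ) (hg : ∀ i, HasCompactSupport (g i)) :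
    𝒢.convFun f (fun γ => ∑ i, g i γ) = fun γ => ∑ i, 𝒢.convFun f (g i) γ := by
  funext γ
  unfold convFun
  rw [← Summable.tsum_finsetSum fun i _ => 𝒢.summable_conv f (hg i) γ]
  simp only [Finset.mul_sum]

theorem continuous_convFun_aux {f g : Γ → ℂ} (hf : Continuous f) (hg : Continuous g)
    (hgc : HasCompactSupport g) (e : OpenPartialHomeomorph Γ X) (he : 𝒢.d = e)
    (hge : tsupport g ⊆ e.source) : Continuous (𝒢.convFun f g) := by
  have := 𝒢.t2Space_units
  rw [continuous_iff_continuousAt]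
  intro γ₀
  have hd : Continuous 𝒢.d := 𝒢.isLocalHomeomorph_d.continuous
  have hzero : ∀ γ, 𝒢.d γ ∉ 𝒢.d '' tsupport g → 𝒢.convFun f g γ = 0 := by
    intro γ hγ
    unfold convFun
    rw [← tsum_zero (α := ℂ) (β := 𝒢.Fiber (𝒢.d γ))]
    refine tsum_congr fun β => ?_
    have : g β.1 = 0 := by
      refine image_eq_zero_of_notMem_tsupport fun h => hγ ⟨β.1, h, β.2⟩
    simp [this]
  by_cases h0 : 𝒢.d γ₀ ∈ 𝒢.d '' tsupport g
  · have hW : IsOpen (𝒢.d ⁻¹' e.target) := e.open_target.preimage hd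
    have hγ₀ : γ₀ ∈ 𝒢.d ⁻¹' e.target := by
      obtain ⟨β, hβ, hβ'⟩ := h0
      rw [Set.mem_preimage, ← hβ', he]
      exact e.map_source (hge hβ)
    have hs : ∀ γ : 𝒢.d ⁻¹' e.target, 𝒢.d (e.symm (𝒢.d γ.1)) = 𝒢.d γ.1 := by
      intro γ
      have := e.right_inv γ.2
      rw [← he] at this
      exact this
    have hcs : Continuous fun γ : 𝒢.d ⁻¹' e.target => e.symm (𝒢.d γ.1) := by
      refine e.symm.continuousOn.comp_continuous (hd.comp continuous_subtype_val) fun γ => γ.2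
    have heq : (fun γ : 𝒢.d ⁻¹' e.target => 𝒢.convFun f g γ.1) = fun γ =>
        f (𝒢.div γ.1 (e.symm (𝒢.d γ.1)) (hs γ).symm) * g (e.symm (𝒢.d γ.1)) := by
      funext γ
      unfold convFun
      rw [tsum_eq_single (⟨e.symm (𝒢.d γ.1), hs γ⟩ : 𝒢.Fiber (𝒢.d γ.1))]
      intro β hβ
      have : g β.1 = 0 := by
        by_contra hne
        have hmem := hge (subset_tsupport g hne)
        apply hβ
        apply Subtype.ext
        change β.1 = e.symm (𝒢.d γ.1)
        have h1 : 𝒢.d γ.1 = e β.1 := β.2.symm.trans (congrFun he β.1)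
        exact (e.left_inv hmem).symm.trans (congrArg e.symm h1.symm)
      simp [this]
    have hcont : Continuous fun γ : 𝒢.d ⁻¹' e.target => 𝒢.convFun f g γ.1 := by
      rw [heq]
      refine Continuous.mul (hf.comp ?_) (hg.comp hcs)
      refine 𝒢.continuous_div.comp (f := fun γ : 𝒢.d ⁻¹' e.target =>
        (⟨(γ.1, e.symm (𝒢.d γ.1)), (hs γ).symm⟩ : {p : Γ × Γ // 𝒢.d p.1 = 𝒢.d p.2})) ?_
      exact (continuous_subtype_val.prodMk hcs).subtype_mk _
    exact (hW.isOpenEmbedding_subtypeVal.continuousAt_iff (x := ⟨γ₀, hγ₀⟩)).1 hcont.continuousAt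
  · have hcl : IsClosed (𝒢.d '' tsupport g) := (hgc.isCompact.image hd).isClosed
    have hev : ∀ᶠ γ in nhds γ₀, 𝒢.convFun f g γ = 0 :=
      ((hcl.isOpen_compl.preimage hd).mem_nhds h0 : _ ∈ nhds γ₀) |> Filter.mem_of_superset <|
        fun γ hγ => hzero γ hγ
    exact (continuousAt_const (y := (0 : ℂ))).congr
      (hev.mono fun γ hγ => hγ.symm)

theorem continuous_convFun (f g : C_c(Γ, ℂ)) : Continuous (𝒢.convFun f g) := by
  have := 𝒢.t2Space
  have := 𝒢.locallyCompactSpace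
  choose e he hpe using 𝒢.isLocalHomeomorph_d
  have hgc : IsCompact (tsupport g) := g.hasCompactSupport
  obtain ⟨t, -, htC⟩ := hgc.elim_nhds_subcover (fun a => (e a).source)
    fun a _ => (e a).open_source.mem_nhds (he a)
  let s : Fin t.card → Γ := fun i => (t.equivFin.symm i : Γ)
  obtain ⟨w, hws, hw1, -, hwc⟩ := exists_continuous_sum_one_of_isOpen_isCompact
    (s := fun i => (e (s i)).source) (t := tsupport g) (fun i => (e (s i)).open_source) hgc (by
      intro y hy
      obtain ⟨a, ha, hya⟩ := Set.mem_iUnion₂.1 (htC hy)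
      refine Set.mem_iUnion.2 ⟨t.equivFin ⟨a, ha⟩, ?_⟩
      simpa [s] using hya)
  let gi : Fin t.card → Γ → ℂ := fun i γ => ((w i γ : ℝ) : ℂ) * g γ
  have hgi : ∀ i, Continuous (gi i) := fun i =>
    (Complex.continuous_ofReal.comp (w i).continuous).mul g.continuous
  have hgis : ∀ i, tsupport (gi i) ⊆ tsupport (w i) := fun i => by
    refine closure_mono fun γ hγ h0 => hγ ?_
    simp [gi, h0]
  have hgic : ∀ i, HasCompactSupport (gi i) := fun i =>
    (hwc i).isCompact.of_isClosed_subset (isClosed_tsupport _) (hgis i)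
  have hsum : (g : Γ → ℂ) = fun γ => ∑ i, gi i γ := by
    funext γ
    by_cases hγ : γ ∈ tsupport g
    · have h1 := hw1 hγ
      simp only [Finset.sum_apply, Pi.one_apply] at h1
      simp only [gi, ← Finset.sum_mul, ← Complex.ofReal_sum, h1]
      simp
    · simp [gi, image_eq_zero_of_notMem_tsupport hγ]
  rw [hsum, 𝒢.convFun_sum _ _ hgic]
  refine continuous_finsetSum _ fun i _ => ?_
  exact 𝒢.continuous_convFun_aux f.continuous (hgi i) (hgic i) (e (s i)) (hpe _)
    ((hgis i).trans (hws i))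

theorem hasCompactSupport_convFun (f g : C_c(Γ, ℂ)) : HasCompactSupport (𝒢.convFun f g) := by
  have := 𝒢.t2Space
  have := 𝒢.t2Space_units
  let C : Set {p : Γ × Γ // 𝒢.d p.1 = 𝒢.r p.2} :=
    Subtype.val ⁻¹' (tsupport f ×ˢ tsupport g)
  have hclosed : IsClosed {p : Γ × Γ | 𝒢.d p.1 = 𝒢.r p.2} :=
    isClosed_eq (𝒢.isLocalHomeomorph_d.continuous.comp continuous_fst)
      (𝒢.isLocalHomeomorph_r.continuous.comp continuous_snd)
  have hC : IsCompact C := hclosed.isClosedEmbedding_subtypeVal.isCompact_preimage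
    (f.hasCompactSupport.isCompact.prod g.hasCompactSupport.isCompact)
  refine HasCompactSupport.intro (hC.image 𝒢.continuous_mul) fun γ hγ => ?_
  unfold convFun
  rw [← tsum_zero (α := ℂ) (β := 𝒢.Fiber (𝒢.d γ))]
  refine tsum_congr fun β => ?_
  by_contra hne
  apply hγ
  refine ⟨⟨(𝒢.div γ β.1 β.2.symm, β.1), 𝒢.d_div _ _ β.2.symm⟩, ⟨?_, ?_⟩,
    𝒢.div_mul_cancel _ _ β.2.symm⟩
  · exact subset_tsupport _ (left_ne_zero_of_mul hne)
  · exact subset_tsupport _ (right_ne_zero_of_mul hne)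

/-- The convolution product on `C_c(𝒢)`. -/
def conv (f g : C_c(Γ, ℂ)) : C_c(Γ, ℂ) where
  toFun := 𝒢.convFun f g
  continuous_toFun := 𝒢.continuous_convFun f g
  hasCompactSupport' := 𝒢.hasCompactSupport_convFun f g

/-- The involution `f*(γ) = conj (f(γ⁻¹))` on `C_c(𝒢)`. -/
def involution (f : C_c(Γ, ℂ)) : C_c(Γ, ℂ) where
  toFun γ := star (f (𝒢.inv γ))
  continuous_toFun := continuous_star.comp (f.continuous.comp 𝒢.continuous_inv)
  hasCompactSupport' := (f.hasCompactSupport.comp_homeomorph 𝒢.invHomeo).comp_left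
    (g := star) (star_zero ℂ)

/-! #### The regular representations and the reduced C*-algebra -/

/-- The matrix `(γ, γ') ↦ f(γ γ'⁻¹)` indexed by `𝒢_u`. -/
def kernel (u : X) (f : C_c(Γ, ℂ)) (γ γ' : 𝒢.Fiber u) : ℂ :=
  f (𝒢.div γ.1 γ'.1 (γ.2.trans γ'.2.symm))

theorem exists_kernelBound (f : C_c(Γ, ℂ)) :
    ∃ (N : ℕ) (M : ℝ), ∀ u, KernelBound (𝒢.kernel u f) N M := by
  obtain ⟨N₁, h₁⟩ := exists_fiber_bound 𝒢.isLocalHomeomorph_r f.hasCompactSupport.isCompact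
  obtain ⟨N₂, h₂⟩ := exists_fiber_bound 𝒢.isLocalHomeomorph_d f.hasCompactSupport.isCompact
  obtain ⟨M, hM⟩ := f.hasCompactSupport.exists_bound_of_continuous f.continuous
  refine ⟨max N₁ N₂, max M 0, fun u => ⟨fun γ => ?_, fun γ' => ?_, fun γ γ' => ?_, ?_⟩⟩
  · refine le_trans ?_ ((h₁ (𝒢.r γ.1)).trans (by exact_mod_cast le_max_left N₁ N₂))
    refine Set.encard_le_encard_of_injOn
      (f := fun γ' : 𝒢.Fiber u => 𝒢.div γ.1 γ'.1 (γ.2.trans γ'.2.symm)) ?_ ?_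
    · exact fun γ' hγ' => ⟨subset_tsupport f hγ', 𝒢.r_div _ _ _⟩
    · exact fun a _ b _ hab => Subtype.ext (𝒢.div_left_injective _ _ hab)
  · refine le_trans ?_ ((h₂ (𝒢.r γ'.1)).trans (by exact_mod_cast le_max_right N₁ N₂))
    refine Set.encard_le_encard_of_injOn
      (f := fun γ : 𝒢.Fiber u => 𝒢.div γ.1 γ'.1 (γ.2.trans γ'.2.symm)) ?_ ?_
    · exact fun γ hγ => ⟨subset_tsupport f hγ, 𝒢.d_div _ _ _⟩
    · exact fun a _ b _ hab => Subtype.ext (𝒢.div_right_injective _ _ hab)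
  · exact (hM _).trans (le_max_left _ _)
  · exact le_max_right _ _

/-- The representation `Ind_u` of `C_c(𝒢)` on `ℓ²(𝒢_u)`. -/
def Ind (u : X) (f : C_c(Γ, ℂ)) : Ell2 (𝒢.Fiber u) ℂ →L[ℂ] Ell2 (𝒢.Fiber u) ℂ :=
  ((𝒢.exists_kernelBound f).choose_spec.choose_spec u).op

theorem Ind_apply (u : X) (f : C_c(Γ, ℂ)) (φ : Ell2 (𝒢.Fiber u) ℂ) (γ : 𝒢.Fiber u) :
    𝒢.Ind u f φ γ =
      ∑' γ' : 𝒢.Fiber u, f (𝒢.div γ.1 γ'.1 (γ.2.trans γ'.2.symm)) * φ γ' := rfl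

theorem entry_Ind (u : X) (f : C_c(Γ, ℂ)) (γ γ' : 𝒢.Fiber u) :
    entry (𝒢.Ind u f) γ γ' = f (𝒢.div γ.1 γ'.1 (γ.2.trans γ'.2.symm)) :=
  entry_op _ _ _

/-- The C*-algebra of bounded families `(T_u)_u` of operators `T_u` on `ℓ²(𝒢_u)`, `u ∈ X`, with the
norm `sup_u ‖T_u‖`. -/
def Families : Type _ := lp (fun u : X => Ell2 (𝒢.Fiber u) ℂ →L[ℂ] Ell2 (𝒢.Fiber u) ℂ) ∞

instance : NonUnitalCStarAlgebra 𝒢.Families :=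
  inferInstanceAs (NonUnitalCStarAlgebra
    (lp (fun u : X => Ell2 (𝒢.Fiber u) ℂ →L[ℂ] Ell2 (𝒢.Fiber u) ℂ) ∞))

instance : CoeFun 𝒢.Families fun _ => ∀ u, Ell2 (𝒢.Fiber u) ℂ →L[ℂ] Ell2 (𝒢.Fiber u) ℂ :=
  ⟨fun T => T.1⟩

theorem norm_families_apply_le {𝒢 : EtaleGroupoid X Γ} (T : 𝒢.Families) (u : X) : ‖T u‖ ≤ ‖T‖ :=
  lp.norm_apply_le_norm (E := fun u : X => Ell2 (𝒢.Fiber u) ℂ →L[ℂ] Ell2 (𝒢.Fiber u) ℂ)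
    (by simp) T u

theorem families_ext_apply {𝒢 : EtaleGroupoid X Γ} {S T : 𝒢.Families} (h : ∀ u, S u = T u) : S = T :=
  Subtype.ext (funext h)

/-- The direct sum `f ↦ (Ind_u f)_u` of all regular representations of `C_c(𝒢)`. Its norm
`sup_u ‖Ind_u f‖` is the reduced norm of `f`. -/
def regular (f : C_c(Γ, ℂ)) : 𝒢.Families :=
  ⟨fun u => 𝒢.Ind u f, memℓp_infty (by
    refine ⟨(𝒢.exists_kernelBound f).choose * (𝒢.exists_kernelBound f).choose_spec.choose, ?_⟩
    rintro _ ⟨u, rfl⟩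
    exact ((𝒢.exists_kernelBound f).choose_spec.choose_spec u).norm_op_le)⟩

@[simp] theorem regular_apply (f : C_c(Γ, ℂ)) (u : X) : 𝒢.regular f u = 𝒢.Ind u f := rfl

theorem families_ext {S T : 𝒢.Families}
    (h : ∀ u γ γ', entry (S u) γ γ' = entry (T u) γ γ') : S = T := by
  exact families_ext_apply fun u => ext_entry (h u)

theorem norm_regular (f : C_c(Γ, ℂ)) : ‖𝒢.regular f‖ = ⨆ u, ‖𝒢.Ind u f‖ := rfl

theorem regular_add (f g : C_c(Γ, ℂ)) : 𝒢.regular (f + g) = 𝒢.regular f + 𝒢.regular g := by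
  refine 𝒢.families_ext fun u γ γ' => ?_
  have : entry ((𝒢.regular f + 𝒢.regular g) u) γ γ' =
    entry (𝒢.Ind u f) γ γ' + entry (𝒢.Ind u g) γ γ' := rfl
  rw [this, regular_apply]
  simp only [entry_Ind]
  rfl

theorem regular_smul (c : ℂ) (f : C_c(Γ, ℂ)) : 𝒢.regular (c • f) = c • 𝒢.regular f := by
  refine 𝒢.families_ext fun u γ γ' => ?_
  have : entry ((c • 𝒢.regular f) u) γ γ' = c * entry (𝒢.Ind u f) γ γ' := rfl
  rw [this, regular_apply]
  simp only [entry_Ind]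
  rfl

theorem regular_zero : 𝒢.regular 0 = 0 := by
  simpa using 𝒢.regular_smul 0 0

theorem regular_conv (f g : C_c(Γ, ℂ)) : 𝒢.regular (𝒢.conv f g) = 𝒢.regular f * 𝒢.regular g := by
  refine 𝒢.families_ext fun u γ γ' => ?_
  have h1 : (𝒢.regular f * 𝒢.regular g) u = 𝒢.Ind u f * 𝒢.Ind u g := rfl
  rw [h1, regular_apply, entry_Ind]
  refine Eq.trans ?_ (entry_mul_op (𝒢.Ind u g)
    ((𝒢.exists_kernelBound f).choose_spec.choose_spec u) γ γ').symm
  change 𝒢.convFun f g _ = _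
  unfold convFun
  have hd := 𝒢.d_div γ.1 γ'.1 (γ.2.trans γ'.2.symm)
  let e : 𝒢.Fiber u ≃ 𝒢.Fiber (𝒢.d (𝒢.div γ.1 γ'.1 (γ.2.trans γ'.2.symm))) :=
    { toFun := fun β => ⟨𝒢.div β.1 γ'.1 (β.2.trans γ'.2.symm), (𝒢.d_div _ _ _).trans hd.symm⟩
      invFun := fun β => ⟨𝒢.mul β.1 γ'.1 (β.2.trans hd), (𝒢.d_mul _ _ _).trans γ'.2⟩
      left_inv := fun β => Subtype.ext
        (𝒢.div_mul_cancel β.1 γ'.1 (β.2.trans γ'.2.symm))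
      right_inv := fun β => Subtype.ext (𝒢.mul_div_cancel β.1 γ'.1 (β.2.trans hd)) }
  rw [← e.tsum_eq]
  refine tsum_congr fun β => ?_
  rw [entry_Ind]
  exact congrArg (fun z => f z * g (𝒢.div β.1 γ'.1 (β.2.trans γ'.2.symm)))
    (𝒢.div_div_div γ.1 β.1 γ'.1 (γ.2.trans γ'.2.symm) (β.2.trans γ'.2.symm)
      (hd.trans (𝒢.d_div β.1 γ'.1 (β.2.trans γ'.2.symm)).symm))

theorem regular_involution (f : C_c(Γ, ℂ)) : 𝒢.regular (𝒢.involution f) = star (𝒢.regular f) := by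
  refine 𝒢.families_ext fun u γ γ' => ?_
  have h1 : (star (𝒢.regular f)) u = star (𝒢.Ind u f) := rfl
  rw [h1, regular_apply, entry_Ind, entry_star, entry_Ind]
  change star (f (𝒢.inv _)) = _
  rw [𝒢.inv_div]

/-- The image of the `*`-algebra `C_c(𝒢)` under the regular representation. -/
def ccAlgebra : NonUnitalStarSubalgebra ℂ 𝒢.Families where
  carrier := Set.range 𝒢.regular
  add_mem' := by
    rintro _ _ ⟨f, rfl⟩ ⟨g, rfl⟩
    exact ⟨f + g, 𝒢.regular_add f g⟩
  zero_mem' := ⟨0, 𝒢.regular_zero⟩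
  mul_mem' := by
    rintro _ _ ⟨f, rfl⟩ ⟨g, rfl⟩
    exact ⟨𝒢.conv f g, 𝒢.regular_conv f g⟩
  smul_mem' := by
    rintro c _ ⟨f, rfl⟩
    exact ⟨c • f, 𝒢.regular_smul c f⟩
  star_mem' := by
    rintro _ ⟨f, rfl⟩
    exact ⟨𝒢.involution f, 𝒢.regular_involution f⟩

/-- The reduced groupoid C*-algebra `C_r^*(𝒢)`: the completion of `C_c(𝒢)` in the reduced norm
`‖f‖ = sup_u ‖Ind_u f‖`, realized as the norm closure of the image of `C_c(𝒢)` under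
`f ↦ (Ind_u f)_u`. -/
def reducedCStar : NonUnitalStarSubalgebra ℂ 𝒢.Families := 𝒢.ccAlgebra.topologicalClosure

instance : NonUnitalCStarAlgebra 𝒢.reducedCStar :=
  have : IsClosed (𝒢.reducedCStar : Set 𝒢.Families) :=
    NonUnitalStarSubalgebra.isClosed_topologicalClosure 𝒢.ccAlgebra
  NonUnitalStarSubalgebra.nonUnitalCStarAlgebra 𝒢.reducedCStar

/-! #### Actions by automorphisms, and dual actions of cocycles -/

/-- `G` acts on the étale groupoid `𝒢` by automorphisms of étale groupoids. -/
structure IsActionByAut (G : Type*) [Group G] [MulAction G X] [MulAction G Γ] : Prop where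
  r_smul : ∀ (g : G) γ, 𝒢.r (g • γ) = g • 𝒢.r γ
  d_smul : ∀ (g : G) γ, 𝒢.d (g • γ) = g • 𝒢.d γ
  smul_mul : ∀ (g : G) a b h h', g • 𝒢.mul a b h = 𝒢.mul (g • a) (g • b) h'
  continuous_smul : ∀ g : G, Continuous fun γ : Γ => g • γ

variable {𝒢}

namespace IsActionByAut

variable {G : Type*} [Group G] [MulAction G X] [MulAction G Γ] (hG : 𝒢.IsActionByAut G)

theorem smul_inv (hG : 𝒢.IsActionByAut G) (g : G) (a : Γ) : g • 𝒢.inv a = 𝒢.inv (g • a) := by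
  have h : 𝒢.d (𝒢.unit (𝒢.d a)) = 𝒢.d a := 𝒢.d_unit _
  have key : ∀ b : Γ, 𝒢.inv b = 𝒢.div (𝒢.inv b) (𝒢.unit (𝒢.r b))
      ((𝒢.d_inv b).trans (𝒢.d_unit _).symm) := by
    intro b
    have h1 : 𝒢.d (𝒢.unit (𝒢.r b)) = 𝒢.r (𝒢.unit (𝒢.r b)) := by rw [𝒢.r_unit, 𝒢.d_unit]
    have h2 : 𝒢.div (𝒢.inv b) (𝒢.unit (𝒢.r b)) ((𝒢.d_inv b).trans (𝒢.d_unit _).symm) =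
      𝒢.mul (𝒢.div (𝒢.inv b) (𝒢.unit (𝒢.r b)) ((𝒢.d_inv b).trans (𝒢.d_unit _).symm))
        (𝒢.unit (𝒢.d (𝒢.div (𝒢.inv b) (𝒢.unit (𝒢.r b))
          ((𝒢.d_inv b).trans (𝒢.d_unit _).symm)))) (𝒢.r_unit _).symm := (𝒢.mul_unit _ _).symm
    rw [h2, 𝒢.mul_congr rfl (b' := 𝒢.unit (𝒢.r b)) (by rw [𝒢.d_div, 𝒢.r_unit]) _ (𝒢.d_div _ _ _),
      𝒢.div_mul_cancel]
  have hmul : ∀ (x y : Γ) (hxy : 𝒢.d x = 𝒢.r y), 𝒢.d (g • x) = 𝒢.r (g • y) := by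
    intro x y hxy
    rw [hG.d_smul, hG.r_smul, hxy]
  have hunit : g • 𝒢.unit (𝒢.d a) = 𝒢.unit (𝒢.d (g • a)) := by
    have e1 := hG.smul_mul g (𝒢.unit (𝒢.d a)) (𝒢.unit (𝒢.d a))
      (by rw [𝒢.r_unit, 𝒢.d_unit]) (hmul _ _ (by rw [𝒢.r_unit, 𝒢.d_unit]))
    have e2 := 𝒢.mul_unit (𝒢.unit (𝒢.d a)) (𝒢.r_unit _).symm
    rw [𝒢.mul_congr rfl (b' := 𝒢.unit (𝒢.d a)) (by rw [𝒢.d_unit]) _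
      (by rw [𝒢.r_unit, 𝒢.d_unit])] at e2
    rw [e2] at e1
    have e3 := 𝒢.mul_div_cancel (g • 𝒢.unit (𝒢.d a)) (g • 𝒢.unit (𝒢.d a))
      (hmul _ _ (by rw [𝒢.r_unit, 𝒢.d_unit]))
    rw [𝒢.div_congr e1.symm rfl _ rfl, 𝒢.div_self, hG.r_smul, 𝒢.r_unit, ← hG.d_smul] at e3
    exact e3.symm
  have e1 := hG.smul_mul g (𝒢.inv a) a (𝒢.d_inv a) (hmul _ _ (𝒢.d_inv a))
  rw [𝒢.inv_mul, hunit] at e1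
  have e2 := 𝒢.mul_div_cancel (g • 𝒢.inv a) (g • a) (hmul _ _ (𝒢.d_inv a))
  have e3 := 𝒢.mul_div_cancel (𝒢.inv (g • a)) (g • a) (𝒢.d_inv _)
  rw [← e2, ← e3]
  exact 𝒢.div_congr (e1.symm.trans (𝒢.inv_mul _ _).symm) rfl _ _

theorem smul_div (hG : 𝒢.IsActionByAut G) (g : G) (a b : Γ) (h : 𝒢.d a = 𝒢.d b) :
    g • 𝒢.div a b h =
      𝒢.div (g • a) (g • b) (by rw [hG.d_smul, hG.d_smul, h]) := by
  unfold div
  have h' : 𝒢.d (g • a) = 𝒢.r (g • 𝒢.inv b) := by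
    rw [hG.d_smul, hG.r_smul, 𝒢.r_inv, h]
  rw [hG.smul_mul g a (𝒢.inv b) _ h']
  exact 𝒢.mul_congr rfl (hG.smul_inv g b) _ _

/-- The homeomorphism `γ ↦ g γ`. -/
def homeo (g : G) : Γ ≃ₜ Γ where
  toFun γ := g • γ
  invFun γ := g⁻¹ • γ
  left_inv γ := by simp
  right_inv γ := by simp
  continuous_toFun := hG.continuous_smul g
  continuous_invFun := hG.continuous_smul g⁻¹

/-- The function `α_g(f)(γ) = f(g⁻¹ γ)`. -/
def translate (g : G) (f : C_c(Γ, ℂ)) : C_c(Γ, ℂ) where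
  toFun γ := f (g⁻¹ • γ)
  continuous_toFun := f.continuous.comp (hG.continuous_smul g⁻¹)
  hasCompactSupport' := f.hasCompactSupport.comp_homeomorph (hG.homeo g⁻¹)

/-- The bijection `γ ↦ g γ` from `𝒢_{g⁻¹ u}` to `𝒢_u`. -/
def fiberEquiv (g : G) (u : X) : 𝒢.Fiber (g⁻¹ • u) ≃ 𝒢.Fiber u where
  toFun γ := ⟨g • γ.1, by rw [hG.d_smul, γ.2, smul_inv_smul]⟩
  invFun γ := ⟨g⁻¹ • γ.1, by rw [hG.d_smul, γ.2]⟩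
  left_inv γ := Subtype.ext (inv_smul_smul _ _)
  right_inv γ := Subtype.ext (smul_inv_smul _ _)

/-- Conjugation by the unitaries `ℓ²(𝒢_{g⁻¹ u}) → ℓ²(𝒢_u)` induced by `γ ↦ g γ`. -/
def conjHom (g : G) : 𝒢.Families →⋆ₙₐ[ℂ] 𝒢.Families where
  toFun T := ⟨fun u => (reindexU (hG.fiberEquiv g u)).conjStarAlgEquiv (T (g⁻¹ • u)),
    memℓp_infty ⟨‖T‖, by
      rintro _ ⟨u, rfl⟩
      refine (StarAlgEquiv.norm_map _ _).trans_le ?_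
      exact norm_families_apply_le T _⟩⟩
  map_smul' c T := families_ext_apply fun u => map_smul _ c (T (g⁻¹ • u))
  map_zero' := families_ext_apply fun u => map_zero _
  map_add' S T := families_ext_apply fun u => map_add _ (S (g⁻¹ • u)) _
  map_mul' S T := families_ext_apply fun u => map_mul _ (S (g⁻¹ • u)) _
  map_star' T := families_ext_apply fun u => map_star _ (T (g⁻¹ • u))

theorem entry_conjHom (g : G) (T : 𝒢.Families) (u : X) (γ γ' : 𝒢.Fiber u) :
    entry (hG.conjHom g T u) γ γ' =
      entry (T (g⁻¹ • u)) ((hG.fiberEquiv g u).symm γ) ((hG.fiberEquiv g u).symm γ') :=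
  entry_reindexU _ _ _ _

theorem entry_congr (T : 𝒢.Families) {u v : X} (h : u = v) (γ γ' : 𝒢.Fiber u) (δ δ' : 𝒢.Fiber v)
    (h1 : γ.1 = δ.1) (h2 : γ'.1 = δ'.1) : entry (T u) γ γ' = entry (T v) δ δ' := by
  subst h
  rw [Subtype.ext h1, Subtype.ext h2]

theorem conjHom_regular (g : G) (f : C_c(Γ, ℂ)) :
    hG.conjHom g (𝒢.regular f) = 𝒢.regular (hG.translate g f) := by
  refine 𝒢.families_ext fun u γ γ' => ?_
  rw [entry_conjHom, regular_apply, regular_apply, entry_Ind, entry_Ind]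
  change f (𝒢.div (g⁻¹ • γ.1) (g⁻¹ • γ'.1) _) = f (g⁻¹ • 𝒢.div γ.1 γ'.1 _)
  rw [hG.smul_div]

/-- The action of `G` on `C_r^*(𝒢)` determined by `α_g(f)(γ) = f(g⁻¹ γ)` for `f ∈ C_c(𝒢)`. -/
def action : G →* (𝒢.reducedCStar ≃⋆ₐ[ℂ] 𝒢.reducedCStar) :=
  restrictAction
    (actionOfHoms hG.conjHom
      (fun T => 𝒢.families_ext fun u γ γ' => by
        rw [entry_conjHom]
        exact entry_congr T (by simp) _ _ _ _ (by simp [fiberEquiv]) (by simp [fiberEquiv]))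
      (fun g h T => 𝒢.families_ext fun u γ γ' => by
        rw [entry_conjHom, entry_conjHom, entry_conjHom]
        exact entry_congr T (by simp [mul_smul]) _ _ _ _ (by simp [fiberEquiv, mul_smul])
          (by simp [fiberEquiv, mul_smul])))
    𝒢.ccAlgebra
    (by
      rintro g _ ⟨f, rfl⟩
      exact ⟨hG.translate g f, (hG.conjHom_regular g f).symm⟩)

end IsActionByAut

variable (𝒢)

/-- A cocycle on `𝒢`: a continuous homomorphism `ρ` from `𝒢` to the topological group `G`. -/
structure IsCocycle {G : Type*} [Group G] [TopologicalSpace G] (ρ : Γ → G) : Prop where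
  continuous : Continuous ρ
  cocycle_mul : ∀ a b h, ρ (𝒢.mul a b h) = ρ a * ρ b

variable {𝒢}

namespace IsCocycle

variable {G : Type*} [Group G] [TopologicalSpace G] {ρ : Γ → G} (hρ : 𝒢.IsCocycle ρ)

/-- The function `γ ↦ ⟨ξ, ρ(γ)⟩ f(γ)`. -/
def twist (ξ : PontryaginDual G) (f : C_c(Γ, ℂ)) : C_c(Γ, ℂ) where
  toFun γ := ((ξ (ρ γ) : Circle) : ℂ) * f γ
  continuous_toFun :=
    ((by fun_prop : Continuous fun z : Circle => (z : ℂ)).comp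
      ((map_continuous ξ).comp hρ.continuous)).mul f.continuous
  hasCompactSupport' := f.hasCompactSupport.mul_left

/-- Conjugation by the multiplication operators with `γ ↦ ⟨ξ, ρ(γ)⟩` on the spaces `ℓ²(𝒢_u)`. -/
def phaseHom (_ : 𝒢.IsCocycle ρ) (ξ : PontryaginDual G) : 𝒢.Families →⋆ₙₐ[ℂ] 𝒢.Families where
  toFun T := ⟨fun u => (phaseU fun γ : 𝒢.Fiber u => ξ (ρ γ.1)).conjStarAlgEquiv (T u),
    memℓp_infty ⟨‖T‖, by
      rintro _ ⟨u, rfl⟩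
      refine (StarAlgEquiv.norm_map _ _).trans_le ?_
      exact norm_families_apply_le T _⟩⟩
  map_smul' c T := families_ext_apply fun u => map_smul _ c (T u)
  map_zero' := families_ext_apply fun u => map_zero _
  map_add' S T := families_ext_apply fun u => map_add _ (S u) _
  map_mul' S T := families_ext_apply fun u => map_mul _ (S u) _
  map_star' T := families_ext_apply fun u => map_star _ (T u)

theorem entry_phaseHom (ξ : PontryaginDual G) (T : 𝒢.Families) (u : X) (γ γ' : 𝒢.Fiber u) :
    entry (hρ.phaseHom ξ T u) γ γ' =
      (ξ (ρ γ.1) : ℂ) * entry (T u) γ γ' * ((ξ (ρ γ'.1))⁻¹ : ℂ) :=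
  entry_phaseU _ _ _ _

theorem phaseHom_regular (ξ : PontryaginDual G) (f : C_c(Γ, ℂ)) :
    hρ.phaseHom ξ (𝒢.regular f) = 𝒢.regular (hρ.twist ξ f) := by
  refine 𝒢.families_ext fun u γ γ' => ?_
  rw [entry_phaseHom, regular_apply, regular_apply, entry_Ind, entry_Ind]
  change _ = ((ξ (ρ (𝒢.div γ.1 γ'.1 _)) : Circle) : ℂ) * _
  have h := hρ.cocycle_mul (𝒢.div γ.1 γ'.1 (γ.2.trans γ'.2.symm)) γ'.1 (𝒢.d_div _ _ _)
  rw [𝒢.div_mul_cancel] at h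
  rw [h, map_mul]
  push_cast
  field_simp [Circle.coe_ne_zero]

/-- The dual action on `C_r^*(𝒢)` induced by the cocycle `ρ`, determined by
`(ξ f)(γ) = ⟨ξ, ρ(γ)⟩ f(γ)` for `f ∈ C_c(𝒢)`. -/
def dualAction : PontryaginDual G →* (𝒢.reducedCStar ≃⋆ₐ[ℂ] 𝒢.reducedCStar) :=
  restrictAction
    (actionOfHoms hρ.phaseHom
      (fun T => 𝒢.families_ext fun u γ γ' => by
        rw [entry_phaseHom]
        simp)
      (fun g h T => 𝒢.families_ext fun u γ γ' => by
        rw [entry_phaseHom, entry_phaseHom, entry_phaseHom]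
        have hmul : ∀ a : G, (g * h) a = g a * h a := fun _ => rfl
        simp only [hmul, Circle.coe_mul, _root_.mul_inv]
        ring))
    𝒢.ccAlgebra
    (by
      rintro ξ _ ⟨f, rfl⟩
      exact ⟨hρ.twist ξ f, (hρ.phaseHom_regular ξ f).symm⟩)

end IsCocycle

end Groupoid

end EtaleGroupoid

/-! ### Reduced crossed products by discrete groups -/

section CrossedProduct

variable {A G H : Type*} [NonUnitalCStarAlgebra A] [Group G] [NormedAddCommGroup H]
  [InnerProductSpace ℂ H] [CompleteSpace H] (α : G →* (A ≃⋆ₐ[ℂ] A)) (π : A →⋆ₙₐ[ℂ] (H →L[ℂ] H))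

/-- The operator `(φ(g))_g ↦ (π(α_{g⁻¹}(a)) φ(h⁻¹ g))_g` on `ℓ²(G, H)`. -/
def covOp (h : G) (a : A) : Ell2 G H →L[ℂ] Ell2 G H :=
  diagOp (fun g => π (α g⁻¹ a)) ‖a‖ (norm_nonneg a)
      (fun _ => (NonUnitalStarAlgHom.norm_apply_le π _).trans (StarAlgEquiv.norm_map _ a).le) ∘L
    (reindexU (E := H) (Equiv.mulLeft h)).toContinuousLinearEquiv.toContinuousLinearMap

theorem covOp_apply (h : G) (a : A) (φ : Ell2 G H) (g : G) :
    covOp α π h a φ g = π (α g⁻¹ a) (φ (h⁻¹ * g)) := rfl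

theorem covOp_zero (h : G) : covOp α π h 0 = 0 := by
  ext φ g
  simp [covOp_apply]

theorem covOp_add (h : G) (a b : A) : covOp α π h (a + b) = covOp α π h a + covOp α π h b := by
  ext φ g
  change covOp α π h (a + b) φ g = covOp α π h a φ g + covOp α π h b φ g
  simp [covOp_apply]

theorem covOp_smul (c : ℂ) (h : G) (a : A) : covOp α π h (c • a) = c • covOp α π h a := by
  ext φ g
  change covOp α π h (c • a) φ g = c • covOp α π h a φ g
  simp [covOp_apply]

theorem covOp_mul (h k : G) (a b : A) :
    covOp α π h a * covOp α π k b = covOp α π (h * k) (a * α h b) := by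
  ext φ g
  change π (α g⁻¹ a) (π (α (h⁻¹ * g)⁻¹ b) (φ (k⁻¹ * (h⁻¹ * g)))) =
    π (α g⁻¹ (a * α h b)) (φ ((h * k)⁻¹ * g))
  rw [map_mul (α g⁻¹), map_mul π, mul_apply_eq_comp, ← StarAlgEquiv.mul_apply,
    ← map_mul α]
  simp [mul_assoc]

theorem covOp_star (h : G) (a : A) : star (covOp α π h a) = covOp α π h⁻¹ (α h⁻¹ (star a)) := by
  rw [ContinuousLinearMap.star_eq_adjoint, eq_comm, ContinuousLinearMap.eq_adjoint_iff]
  intro φ ψ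
  rw [lp.inner_eq_tsum, lp.inner_eq_tsum, 
    ← (Equiv.mulLeft h).tsum_eq fun g => ⟪φ g, covOp α π h a ψ g⟫_ℂ]
  refine tsum_congr fun g => ?_
  rw [Equiv.coe_mulLeft, covOp_apply, covOp_apply, ← StarAlgEquiv.mul_apply, ← map_mul α,
    map_star, map_star, ContinuousLinearMap.star_eq_adjoint,
    ContinuousLinearMap.adjoint_inner_left]
  simp

/-- The integrated form of the regular representation of `(A, G, α)` induced by `π`: the operator
`(π̃(ξ) φ)(g) = ∑ₕ π(α_{g⁻¹}(ξ(h))) φ(h⁻¹ g)` on `ℓ²(G, H)`. As `G` is discrete, `C_c(G, A)` is the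
space of finitely supported functions `ξ : G → A`. -/
def integrated (ξ : G →₀ A) : Ell2 G H →L[ℂ] Ell2 G H := ξ.sum fun h a => covOp α π h a

theorem integrated_apply (ξ : G →₀ A) (φ : Ell2 G H) (g : G) :
    integrated α π ξ φ g = ∑ h ∈ ξ.support, π (α g⁻¹ (ξ h)) (φ (h⁻¹ * g)) := by
  unfold integrated Finsupp.sum
  rw [_root_.sum_apply, lp.coeFn_sum, Finset.sum_apply]
  rfl

theorem integrated_single (h : G) (a : A) :
    integrated α π (Finsupp.single h a) = covOp α π h a :=
  Finsupp.sum_single_index (covOp_zero α π h)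

theorem integrated_add (ξ η : G →₀ A) :
    integrated α π (ξ + η) = integrated α π ξ + integrated α π η := by
  classical
  exact Finsupp.sum_add_index' (covOp_zero α π) (covOp_add α π)

theorem integrated_zero : integrated α π 0 = 0 := Finsupp.sum_zero_index

theorem integrated_smul (c : ℂ) (ξ : G →₀ A) : integrated α π (c • ξ) = c • integrated α π ξ := by
  unfold integrated
  rw [Finsupp.sum_smul_index' (covOp_zero α π), Finsupp.smul_sum]
  simp only [covOp_smul]

theorem integrated_sum {ι : Type*} (s : Finset ι) (ξ : ι → G →₀ A) :
    integrated α π (∑ i ∈ s, ξ i) = ∑ i ∈ s, integrated α π (ξ i) :=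
  map_sum (AddMonoidHom.mk' (integrated α π) (integrated_add α π)) ξ s

/-- The twisted convolution `(ξ * η)(g) = ∑ₕ ξ(h) α_h(η(h⁻¹ g))` on `C_c(G, A)`. -/
def twistedConv (ξ η : G →₀ A) : G →₀ A :=
  ξ.sum fun h a => η.sum fun k b => Finsupp.single (h * k) (a * α h b)

/-- The involution `ξ*(g) = α_g(ξ(g⁻¹)*)` on `C_c(G, A)`. -/
def twistedStar (ξ : G →₀ A) : G →₀ A :=
  ξ.sum fun h a => Finsupp.single h⁻¹ (α h⁻¹ (star a))

theorem integrated_twistedConv (ξ η : G →₀ A) :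
    integrated α π (twistedConv α ξ η) = integrated α π ξ * integrated α π η := by
  unfold twistedConv Finsupp.sum
  simp only [integrated_sum, integrated_single, ← covOp_mul]
  rw [integrated, integrated, Finsupp.sum, Finsupp.sum, Finset.sum_mul_sum]

theorem integrated_twistedStar (ξ : G →₀ A) :
    integrated α π (twistedStar α ξ) = star (integrated α π ξ) := by
  unfold twistedStar Finsupp.sum
  simp only [integrated_sum, integrated_single, ← covOp_star]
  rw [integrated, Finsupp.sum, star_sum]

/-- The image of the `*`-algebra `C_c(G, A)` under the regular representation induced by `π`. -/
def crossedAlgebra : NonUnitalStarSubalgebra ℂ (Ell2 G H →L[ℂ] Ell2 G H) where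
  carrier := Set.range (integrated α π)
  add_mem' := by
    rintro _ _ ⟨ξ, rfl⟩ ⟨η, rfl⟩
    exact ⟨ξ + η, integrated_add α π ξ η⟩
  zero_mem' := ⟨0, integrated_zero α π⟩
  mul_mem' := by
    rintro _ _ ⟨ξ, rfl⟩ ⟨η, rfl⟩
    exact ⟨twistedConv α ξ η, integrated_twistedConv α π ξ η⟩
  smul_mem' := by
    rintro c _ ⟨ξ, rfl⟩
    exact ⟨c • ξ, integrated_smul α π c ξ⟩
  star_mem' := by
    rintro _ ⟨ξ, rfl⟩
    exact ⟨twistedStar α ξ, integrated_twistedStar α π ξ⟩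

/-- The reduced crossed product `A ⋊_{α,r} G` of a C*-algebra `A` by an action `α` of a discrete
group `G`, formed with a representation `π` of `A` (which has to be faithful): the completion of
`C_c(G, A)` in the norm `‖π̃(ξ)‖` of the regular representation induced by `π`, realized as the
norm closure of the image of `C_c(G, A)` in the bounded operators on `ℓ²(G, H)`. -/
def reducedCrossedProduct : NonUnitalStarSubalgebra ℂ (Ell2 G H →L[ℂ] Ell2 G H) :=
  (crossedAlgebra α π).topologicalClosure

section Dual

variable [TopologicalSpace G]

/-- The function `g ↦ ⟨χ, g⟩ ξ(g)`. -/
def crossedTwist (χ : PontryaginDual G) (ξ : G →₀ A) : G →₀ A :=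
  Finsupp.onFinset ξ.support (fun g => ((χ g : Circle) : ℂ) • ξ g) fun g hg => by
    rw [Finsupp.mem_support_iff]
    intro h0
    simp [h0] at hg

/-- Conjugation by the multiplication operators with characters on `ℓ²(G, H)`. -/
def crossedPhase :
    PontryaginDual G →* ((Ell2 G H →L[ℂ] Ell2 G H) ≃⋆ₐ[ℂ] (Ell2 G H →L[ℂ] Ell2 G H)) where
  toFun χ := (phaseU fun g => χ g).conjStarAlgEquiv
  map_one' := by
    ext T φ g
    rw [LinearIsometryEquiv.conjStarAlgEquiv_apply_apply]
    have h : (phaseU fun g : G => (1 : PontryaginDual G) g).symm φ = φ := by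
      ext g
      simp
    rw [h]
    simp
  map_mul' χ ψ := by
    ext T φ g
    have hmul : ∀ a : G, (χ * ψ) a = χ a * ψ a := fun _ => rfl
    rw [StarAlgEquiv.mul_apply, LinearIsometryEquiv.conjStarAlgEquiv_apply_apply,
      LinearIsometryEquiv.conjStarAlgEquiv_apply_apply,
      LinearIsometryEquiv.conjStarAlgEquiv_apply_apply]
    have h : (phaseU fun g : G => (χ * ψ) g).symm φ =
        (phaseU fun g : G => ψ g).symm ((phaseU fun g : G => χ g).symm φ) := by
      ext g
      simp only [phaseU_symm_apply, hmul, Circle.coe_mul, smul_smul]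
      rw [mul_inv, mul_comm]
    rw [h]
    simp only [phaseU_apply, hmul, Circle.coe_mul, smul_smul]

theorem crossedPhase_apply (χ : PontryaginDual G) (T : Ell2 G H →L[ℂ] Ell2 G H)
    (φ : Ell2 G H) (g : G) :
    crossedPhase (H := H) χ T φ g = ((χ g : Circle) : ℂ) • T ((phaseU fun g => χ g).symm φ) g := rfl

theorem crossedPhase_integrated (χ : PontryaginDual G) (ξ : G →₀ A) :
    crossedPhase (H := H) χ (integrated α π ξ) = integrated α π (crossedTwist χ ξ) := by
  ext φ g
  have h1 : integrated α π (crossedTwist χ ξ) φ g =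
      ∑ h ∈ ξ.support, π (α g⁻¹ (crossedTwist χ ξ h)) (φ (h⁻¹ * g)) := by
    rw [integrated_apply]
    refine Finset.sum_subset Finsupp.support_onFinset_subset fun h _ hh => ?_
    rw [Finsupp.notMem_support_iff.1 hh]
    simp
  rw [h1, crossedPhase_apply, integrated_apply, Finset.smul_sum]
  refine Finset.sum_congr rfl fun h _ => ?_
  change _ = π (α g⁻¹ (((χ h : Circle) : ℂ) • ξ h)) (φ (h⁻¹ * g))
  rw [phaseU_symm_apply, map_smul, map_smul, map_smul, smul_smul, map_mul χ, map_inv χ]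
  rw [_root_.smul_apply]
  congr 1
  push_cast
  field_simp [Circle.coe_ne_zero]

/-- The dual action `α̂` of the dual group of `G` on `A ⋊_{α,r} G`, determined by
`α̂_χ(ξ)(g) = ⟨χ, g⟩ ξ(g)` for `ξ ∈ C_c(G, A)`. -/
def crossedDualAction :
    PontryaginDual G →* (reducedCrossedProduct α π ≃⋆ₐ[ℂ] reducedCrossedProduct α π) :=
  restrictAction crossedPhase (crossedAlgebra α π) (by
    rintro χ _ ⟨ξ, rfl⟩
    exact ⟨crossedTwist χ ξ, (crossedPhase_integrated α π χ ξ).symm⟩)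

end Dual

end CrossedProduct

/-! ### Étale equivalence relations and automorphism systems -/

/-- The elements `(x, y)` of an equivalence relation `R`, as a type of its own: it does not carry
the relative product topology. -/
@[ext]
structure RelArrow {X : Type*} (R : Setoid X) where
  fst : X
  snd : X
  rel : R fst snd

namespace RelArrow

variable {X : Type*} {R : Setoid X}

/-- The unit `(x, x)`. -/
def diag (R : Setoid X) (x : X) : RelArrow R := ⟨x, x, R.refl x⟩

/-- The inverse `(x, y)⁻¹ = (y, x)`. -/
def symm (a : RelArrow R) : RelArrow R := ⟨a.snd, a.fst, R.symm a.rel⟩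

/-- The product `(x, y)(y, z) = (x, z)`. -/
def comp (a b : RelArrow R) (h : a.snd = b.fst) : RelArrow R :=
  ⟨a.fst, b.snd, R.trans a.rel (h ▸ b.rel)⟩

end RelArrow

/-- The given topology on `R` makes it a (second countable) étale groupoid, whose unit space is
identified with `X` as a topological space: `R` is an étale equivalence relation on `X`. Local
compactness and the Hausdorff property are automatic for compact Hausdorff `X`. -/
class IsEtaleRel {X : Type*} [TopologicalSpace X] (R : Setoid X) [TopologicalSpace (RelArrow R)] :
    Prop where
  secondCountableTopology : SecondCountableTopology (RelArrow R)
  continuous_diag : Continuous (RelArrow.diag R)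
  continuous_symm : Continuous (RelArrow.symm : RelArrow R → RelArrow R)
  continuous_comp : Continuous fun p : {p : RelArrow R × RelArrow R // p.1.snd = p.2.fst} =>
    RelArrow.comp p.1.1 p.1.2 p.2
  isLocalHomeomorph_fst : IsLocalHomeomorph (RelArrow.fst : RelArrow R → X)
  isLocalHomeomorph_snd : IsLocalHomeomorph (RelArrow.snd : RelArrow R → X)

/-- An automorphism system `G ↷ (X, R)`: the group `G` acts on `X` so that each
`(x, y) ↦ (g x, g y)` is an automorphism of the étale groupoid `R`. The inverse is the map given by
`g⁻¹`, and the action on the unit space `X` is then by homeomorphisms. -/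
class IsAutSystem (G : Type*) {X : Type*} [Group G] [MulAction G X] (R : Setoid X)
    [TopologicalSpace (RelArrow R)] : Prop where
  smul_rel : ∀ (g : G) {x y : X}, R x y → R (g • x) (g • y)
  continuous_smul : ∀ g : G, Continuous fun a : RelArrow R =>
    (⟨g • a.fst, g • a.snd, smul_rel g a.rel⟩ : RelArrow R)

section Rel

variable {X : Type*} [TopologicalSpace X] [CompactSpace X] [T2Space X] (R : Setoid X)
  [TopologicalSpace (RelArrow R)] [IsEtaleRel R]

theorem RelArrow.t2Space : T2Space (RelArrow R) :=
  T2Space.of_injective_continuous (f := fun a : RelArrow R => (a.fst, a.snd))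
    (fun _ _ h => RelArrow.ext (congrArg Prod.fst h) (congrArg Prod.snd h))
    ((IsEtaleRel.isLocalHomeomorph_fst (R := R)).continuous.prodMk
      (IsEtaleRel.isLocalHomeomorph_snd (R := R)).continuous)

theorem RelArrow.locallyCompactSpace : LocallyCompactSpace (RelArrow R) := by
  choose e he hpe using IsEtaleRel.isLocalHomeomorph_fst (R := R)
  let _ : ChartedSpace X (RelArrow R) :=
    { atlas := Set.univ
      chartAt := e
      mem_chart_source := he
      chart_mem_atlas := fun _ => Set.mem_univ _ }
  exact ChartedSpace.locallyCompactSpace X (RelArrow R)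

/-- The étale groupoid of an étale equivalence relation on a compact Hausdorff space. -/
def relGroupoid : EtaleGroupoid X (RelArrow R) where
  r := RelArrow.fst
  d := RelArrow.snd
  unit := RelArrow.diag R
  inv := RelArrow.symm
  mul := RelArrow.comp
  r_unit _ := rfl
  d_unit _ := rfl
  r_inv _ := rfl
  d_inv _ := rfl
  r_mul _ _ _ := rfl
  d_mul _ _ _ := rfl
  mul_assoc _ _ _ _ _ _ _ := rfl
  unit_mul _ _ := rfl
  mul_unit _ _ := rfl
  inv_mul _ _ := rfl
  mul_inv _ _ := rfl
  continuous_unit := IsEtaleRel.continuous_diag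
  continuous_inv := IsEtaleRel.continuous_symm
  continuous_mul := IsEtaleRel.continuous_comp
  isLocalHomeomorph_r := IsEtaleRel.isLocalHomeomorph_fst
  isLocalHomeomorph_d := IsEtaleRel.isLocalHomeomorph_snd
  t2Space := RelArrow.t2Space R
  locallyCompactSpace := RelArrow.locallyCompactSpace R
  secondCountableTopology := IsEtaleRel.secondCountableTopology

section Action

variable (G : Type*) [Group G] [MulAction G X] [IsAutSystem G R]

/-- The action `g (x, y) = (g x, g y)` of `G` on `R`. -/
instance RelArrow.mulAction {X : Type*} {R : Setoid X} [TopologicalSpace (RelArrow R)] {G : Type*}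
    [Group G] [MulAction G X] [IsAutSystem G R] : MulAction G (RelArrow R) where
  smul g a := ⟨g • a.fst, g • a.snd, IsAutSystem.smul_rel g a.rel⟩
  one_smul _ := RelArrow.ext (one_smul G _) (one_smul G _)
  mul_smul _ _ _ := RelArrow.ext (mul_smul _ _ _) (mul_smul _ _ _)

theorem relGroupoid_isActionByAut : (relGroupoid R).IsActionByAut G where
  r_smul _ _ := rfl
  d_smul _ _ := rfl
  smul_mul _ _ _ _ _ := rfl
  continuous_smul g := IsAutSystem.continuous_smul g

/-- The C*-dynamical system `(C_r^*(R), G, α)`, with `α_g(f)(x, y) = f(g⁻¹ x, g⁻¹ y)` for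
`f ∈ C_c(R)`. -/
def relAction : G →* ((relGroupoid R).reducedCStar ≃⋆ₐ[ℂ] (relGroupoid R).reducedCStar) :=
  (relGroupoid_isActionByAut R G).action

end Action

end Rel

/-! ### The semi-direct product groupoid -/

/-- The set `R ⋊_α G` of triples `(x, g, y)` with `(x, g y) ∈ R`. -/
@[ext]
structure SemiArrow {X : Type*} (R : Setoid X) (G : Type*) [Group G] [MulAction G X] where
  fst : X
  grp : G
  snd : X
  rel : R fst (grp • snd)

namespace SemiArrow

variable {X : Type*} {R : Setoid X} {G : Type*} [Group G] [MulAction G X]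

/-- The map `γ₀ (x, g, y) = ((x, g y), g)`. -/
def toProd (a : SemiArrow R G) : RelArrow R × G := (⟨a.fst, a.grp • a.snd, a.rel⟩, a.grp)

/-- The bijection `γ₀ : R ⋊_α G → R × G`, `(x, g, y) ↦ ((x, g y), g)`, with inverse
`((x, y), g) ↦ (x, g, g⁻¹ y)`. -/
def equivProd : SemiArrow R G ≃ RelArrow R × G where
  toFun := toProd
  invFun p := ⟨p.1.fst, p.2, p.2⁻¹ • p.1.snd, by rw [smul_inv_smul]; exact p.1.rel⟩
  left_inv a := by
    refine SemiArrow.ext rfl rfl ?_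
    exact inv_smul_smul a.grp a.snd
  right_inv p := by
    refine Prod.ext (RelArrow.ext rfl ?_) rfl
    exact smul_inv_smul p.2 p.1.snd

/-- The topology transferred from the product topology of `R × G` along the bijection `γ₀`. -/
instance [TopologicalSpace (RelArrow R)] [TopologicalSpace G] : TopologicalSpace (SemiArrow R G) :=
  TopologicalSpace.induced toProd inferInstance

/-- The bijection `γ₀` as a homeomorphism. -/
def homeoProd [TopologicalSpace (RelArrow R)] [TopologicalSpace G] :
    SemiArrow R G ≃ₜ RelArrow R × G :=
  equivProd.toHomeomorphOfIsInducing ⟨rfl⟩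

variable [TopologicalSpace (RelArrow R)] [IsAutSystem G R]

/-- The unit `(x, e, x)`. -/
def unit (R : Setoid X) (G : Type*) [Group G] [MulAction G X] (x : X) : SemiArrow R G :=
  ⟨x, 1, x, by rw [one_smul]⟩

/-- The inverse `(x, g, y)⁻¹ = (y, g⁻¹, x)`. -/
def inv (a : SemiArrow R G) : SemiArrow R G :=
  ⟨a.snd, a.grp⁻¹, a.fst, R.symm (by
    have := IsAutSystem.smul_rel (R := R) a.grp⁻¹ a.rel
    rwa [inv_smul_smul] at this)⟩

/-- The product `(x, g, y)(y, h, v) = (x, gh, v)`. -/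
def mul (a b : SemiArrow R G) (h : a.snd = b.fst) : SemiArrow R G :=
  ⟨a.fst, a.grp * b.grp, b.snd, R.trans a.rel (by
    have := IsAutSystem.smul_rel (R := R) a.grp b.rel
    rwa [← h, smul_smul] at this)⟩

end SemiArrow

section Semi

variable {X : Type*} [TopologicalSpace X] [CompactSpace X] [T2Space X] (R : Setoid X)
  [TopologicalSpace (RelArrow R)] [IsEtaleRel R] (G : Type*) [Group G] [TopologicalSpace G]
  [DiscreteTopology G] [Countable G] [MulAction G X] [IsAutSystem G R]

theorem isLocalHomeomorph_fst_discrete {Y : Type*} [TopologicalSpace Y] :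
    IsLocalHomeomorph (Prod.fst : Y × G → Y) := by
  refine isLocalHomeomorph_iff_isOpenEmbedding_restrict.2 fun p => ?_
  refine ⟨Set.univ ×ˢ {p.2}, (isOpen_univ.prod (isOpen_discrete _)).mem_nhds (by simp), ?_⟩
  refine Topology.IsOpenEmbedding.of_continuous_injective_isOpenMap ?_ ?_ ?_
  · exact continuous_fst.comp continuous_subtype_val
  · rintro ⟨⟨a, g⟩, ha⟩ ⟨⟨b, h⟩, hb⟩ hab
    have h1 : g = p.2 := ha.2
    have h2 : h = p.2 := hb.2
    have h3 : a = b := hab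
    subst h3
    simp [h1, h2]
  · exact isOpenMap_fst.comp (isOpen_univ.prod (isOpen_discrete _)).isOpenMap_subtype_val

theorem continuous_smul_discrete : Continuous fun p : G × RelArrow R => p.1 • p.2 :=
  continuous_prod_of_discrete_left.2 fun g => IsAutSystem.continuous_smul g

/-- The homeomorphism `(a, g) ↦ (g⁻¹ a, g)` of `R × G`. -/
def shearHomeo : RelArrow R × G ≃ₜ RelArrow R × G where
  toFun p := (p.2⁻¹ • p.1, p.2)
  invFun p := (p.2 • p.1, p.2)
  left_inv p := by simp
  right_inv p := by simp
  continuous_toFun := ((continuous_smul_discrete R G).comp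
    ((continuous_of_discreteTopology.comp continuous_snd).prodMk continuous_fst)).prodMk
      continuous_snd
  continuous_invFun := ((continuous_smul_discrete R G).comp
    (continuous_snd.prodMk continuous_fst)).prodMk continuous_snd

theorem SemiArrow.isLocalHomeomorph_fst :
    IsLocalHomeomorph (SemiArrow.fst : SemiArrow R G → X) :=
  (IsEtaleRel.isLocalHomeomorph_fst (R := R)).comp
    ((isLocalHomeomorph_fst_discrete G).comp SemiArrow.homeoProd.isLocalHomeomorph)

theorem SemiArrow.isLocalHomeomorph_snd :
    IsLocalHomeomorph (SemiArrow.snd : SemiArrow R G → X) := by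
  have h := (IsEtaleRel.isLocalHomeomorph_snd (R := R)).comp
    ((isLocalHomeomorph_fst_discrete G).comp
      ((shearHomeo R G).isLocalHomeomorph.comp SemiArrow.homeoProd.isLocalHomeomorph))
  convert h using 1
  funext a
  exact (inv_smul_smul a.grp a.snd).symm

theorem SemiArrow.continuous_toProd_iff {Z : Type*} [TopologicalSpace Z] {f : Z → SemiArrow R G} :
    Continuous f ↔ Continuous fun z => (f z).toProd := continuous_induced_rng

theorem SemiArrow.continuous_toProd :
    Continuous (SemiArrow.toProd : SemiArrow R G → RelArrow R × G) := continuous_induced_dom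

/-- The semi-direct product groupoid `R ⋊_α G`. -/
def semidirectGroupoid : EtaleGroupoid X (SemiArrow R G) where
  r := SemiArrow.fst
  d := SemiArrow.snd
  unit := SemiArrow.unit R G
  inv := SemiArrow.inv
  mul := SemiArrow.mul
  r_unit _ := rfl
  d_unit _ := rfl
  r_inv _ := rfl
  d_inv _ := rfl
  r_mul _ _ _ := rfl
  d_mul _ _ _ := rfl
  mul_assoc _ _ _ _ _ _ _ := SemiArrow.ext rfl (mul_assoc _ _ _) rfl
  unit_mul _ _ := SemiArrow.ext rfl (one_mul _) rfl
  mul_unit _ _ := SemiArrow.ext rfl (mul_one _) rfl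
  inv_mul _ _ := SemiArrow.ext rfl (inv_mul_cancel _) rfl
  mul_inv _ _ := SemiArrow.ext rfl (mul_inv_cancel _) rfl
  continuous_unit := by
    rw [SemiArrow.continuous_toProd_iff]
    have h : (fun x : X => (SemiArrow.unit R G x).toProd) = fun x => (RelArrow.diag R x, 1) := by
      funext x
      exact Prod.ext (RelArrow.ext rfl (one_smul G x)) rfl
    rw [h]
    exact IsEtaleRel.continuous_diag.prodMk continuous_const
  continuous_inv := by
    rw [SemiArrow.continuous_toProd_iff]
    have h : (fun a : SemiArrow R G => a.inv.toProd) =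
        fun a => (a.toProd.2⁻¹ • a.toProd.1.symm, a.toProd.2⁻¹) := by
      funext a
      exact Prod.ext (RelArrow.ext (inv_smul_smul a.grp a.snd).symm rfl) rfl
    rw [h]
    have h1 := SemiArrow.continuous_toProd R G
    have h2 : Continuous fun a : SemiArrow R G => a.toProd.2⁻¹ :=
      continuous_of_discreteTopology.comp (continuous_snd.comp h1)
    exact ((continuous_smul_discrete R G).comp
      (h2.prodMk (IsEtaleRel.continuous_symm.comp (continuous_fst.comp h1)))).prodMk h2
  continuous_mul := by
    rw [SemiArrow.continuous_toProd_iff]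
    have h1 := SemiArrow.continuous_toProd R G
    have ha : Continuous fun p : {p : SemiArrow R G × SemiArrow R G // p.1.snd = p.2.fst} =>
        p.1.1.toProd := h1.comp (continuous_fst.comp continuous_subtype_val)
    have hb : Continuous fun p : {p : SemiArrow R G × SemiArrow R G // p.1.snd = p.2.fst} =>
        p.1.2.toProd := h1.comp (continuous_snd.comp continuous_subtype_val)
    have hsm := (continuous_smul_discrete R G).comp
      ((continuous_snd.comp ha).prodMk (continuous_fst.comp hb))
    have hcomp := (IsEtaleRel.continuous_comp (R := R)).comp
      (((continuous_fst.comp ha).prodMk hsm).subtype_mk fun p => congrArg (p.1.1.grp • ·) p.2)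
    have hmul : Continuous fun p : {p : SemiArrow R G × SemiArrow R G // p.1.snd = p.2.fst} =>
        p.1.1.grp * p.1.2.grp :=
      (continuous_of_discreteTopology (f := fun q : G × G => q.1 * q.2)).comp
        ((continuous_snd.comp ha).prodMk (continuous_snd.comp hb))
    refine (hcomp.prodMk hmul).congr fun p => ?_
    exact Prod.ext (RelArrow.ext rfl (smul_smul _ _ _)) rfl
  isLocalHomeomorph_r := SemiArrow.isLocalHomeomorph_fst R G
  isLocalHomeomorph_d := SemiArrow.isLocalHomeomorph_snd R G
  t2Space := by
    have := RelArrow.t2Space R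
    exact SemiArrow.homeoProd.isEmbedding.t2Space
  locallyCompactSpace := by
    have := RelArrow.locallyCompactSpace R
    exact (SemiArrow.homeoProd (R := R) (G := G)).isClosedEmbedding.locallyCompactSpace
  secondCountableTopology := by
    have : SecondCountableTopology (RelArrow R) := IsEtaleRel.secondCountableTopology
    exact (SemiArrow.homeoProd (R := R) (G := G)).secondCountableTopology

/-- The canonical cocycle `ρ_α : R ⋊_α G → G`, `(x, g, y) ↦ g`. -/
theorem semidirect_isCocycle :
    (semidirectGroupoid R G).IsCocycle (SemiArrow.grp : SemiArrow R G → G) where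
  continuous := continuous_snd.comp (SemiArrow.continuous_toProd R G)
  cocycle_mul _ _ _ := rfl

end Semi

end EtaleCrossed

end

open EtaleCrossed

/-!
The two algebras are completions of essentially the same `*`-algebra, and the point is that the two
norms agree.

For a unit `u`, the map `(x, g, u) ↦ (g, (g⁻¹ x, u))` is a bijection from `(R ⋊_α G)_u` onto
`G × R_u`, so it induces a unitary `ℓ²((R ⋊_α G)_u) ≅ ℓ²(G, ℓ²(R_u))` (`semiU`). Under this unitary,
the regular representation `Ind_u` of a function on `R ⋊_α G` becomes the regular representation of
`C_c(G, C_r^*(R))` induced by the representation `Ind_u` of `C_r^*(R)`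
(`crossedFamily_single_ccElem`). Transporting all of `C_c(G, C_r^*(R))` in this way
(`crossedFamily`) gives a `*`-algebra of families of operators whose closure is `C_r^*(R ⋊_α G)`
(`closure_range_crossedFamily`).

It remains to compare with the crossed product formed with an arbitrary faithful `π`. Write `A` for
`C_r^*(R)`. The compression of the regular representation of `ξ` to `ℓ²(F, H)`, for a finite set `F`
of elements of `G`, is the image under `π` of the matrix `(α_{g⁻¹}(ξ(g k⁻¹)))_{g, k ∈ F}` over `A`
(`trunc_integrated`). As injective `*`-homomorphisms of C*-algebras are isometric, its norm does not
depend on `π`, and the same holds with a jointly faithful family in place of `π`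
(`norm_integrated_le_of_jointly_injective`). The representations `Ind_u` of `C_r^*(R)` are such
a family, whence the equality of norms (`norm_crossedFamily`).

The isomorphism is obtained from its graph, the closure of the set of pairs of images of the
elements of `C_c(G, C_r^*(R))` (`exists_starAlgEquiv_of_norm_eq`). In both pictures the dual action is
conjugation by the multiplication operators with the characters of `G`, and multiplies `ξ(g)` by
`⟨χ, g⟩`; so the graph is invariant under it, which is the equivariance of the isomorphism.
-/

namespace EtaleCrossed

noncomputable section

/-! ### Jointly faithful families of representations -/

/-- A jointly faithful family of representations computes the norm, because its direct sum is an
injective, hence isometric, `*`-homomorphism. -/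
theorem norm_le_of_jointly_injective {B ι : Type*} [NonUnitalCStarAlgebra B] {K : ι → Type*}
    [∀ i, NormedAddCommGroup (K i)] [∀ i, InnerProductSpace ℂ (K i)] [∀ i, CompleteSpace (K i)]
    (τ : ∀ i, B →⋆ₙₐ[ℂ] (K i →L[ℂ] K i)) (hτ : ∀ b, (∀ i, τ i b = 0) → b = 0) {b : B} {C : ℝ}
    (hC : 0 ≤ C) (h : ∀ i, ‖τ i b‖ ≤ C) : ‖b‖ ≤ C := by
  let τ' : B →⋆ₙₐ[ℂ] lp (fun i => K i →L[ℂ] K i) ∞ :=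
    { toFun := fun b => ⟨fun i => τ i b, memℓp_infty ⟨‖b‖, by
        rintro _ ⟨i, rfl⟩
        exact NonUnitalStarAlgHom.norm_apply_le (τ i) b⟩⟩
      map_smul' := fun c b => Subtype.ext (funext fun i => map_smul (τ i) c b)
      map_zero' := Subtype.ext (funext fun i => map_zero (τ i))
      map_add' := fun a b => Subtype.ext (funext fun i => map_add (τ i) a b)
      map_mul' := fun a b => Subtype.ext (funext fun i => map_mul (τ i) a b)
      map_star' := fun b => Subtype.ext (funext fun i => map_star (τ i) b) }
  have hinj : Function.Injective τ' := by
    refine (injective_iff_map_eq_zero τ').2 fun b hb => hτ b fun i => ?_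
    exact congrFun (congrArg Subtype.val hb) i
  rw [← NonUnitalStarAlgHom.norm_map τ' hinj b]
  exact lp.norm_le_of_forall_le hC h

/-! ### Matrix coefficients of operators on `ℓ²(I, E)` -/

section Coefficients

variable {I E : Type*} [NormedAddCommGroup E] [InnerProductSpace ℂ E]

/-- The isometric inclusion `E → ℓ²(I, E)` of the `i`-th summand. -/
def inclCLM (i : I) : E →L[ℂ] Ell2 I E := by
  classical exact lp.singleContinuousLinearMap ℂ (fun _ : I => E) 2 i

/-- The coordinate map `φ ↦ φ i`. -/
def coordCLM (i : I) : Ell2 I E →L[ℂ] E :=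
  lp.evalCLM ℂ (fun _ : I => E) 2 i

theorem inclCLM_apply [DecidableEq I] (i : I) (v : E) : inclCLM i v = lp.single 2 i v := by
  obtain rfl : ‹DecidableEq I› = fun a b => Classical.propDecidable (a = b) :=
    Subsingleton.elim _ _
  rfl

@[simp] theorem coordCLM_apply (i : I) (φ : Ell2 I E) : coordCLM i φ = φ i := rfl

theorem coordCLM_comp_inclCLM_self (i : I) :
    (coordCLM i : Ell2 I E →L[ℂ] E) ∘L inclCLM i = ContinuousLinearMap.id ℂ E := by
  classical
  ext v
  simp [inclCLM_apply]

theorem coordCLM_comp_inclCLM_of_ne {i j : I} (h : i ≠ j) :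
    (coordCLM i : Ell2 I E →L[ℂ] E) ∘L inclCLM j = 0 := by
  classical
  ext v
  simp [inclCLM_apply, h]

theorem adjoint_inclCLM [CompleteSpace E] (i : I) :
    ContinuousLinearMap.adjoint (inclCLM i : E →L[ℂ] Ell2 I E) = coordCLM i := by
  classical
  rw [eq_comm, ContinuousLinearMap.eq_adjoint_iff]
  intro φ v
  rw [inclCLM_apply, lp.inner_single_right, coordCLM_apply]

theorem adjoint_coordCLM [CompleteSpace E] (i : I) :
    ContinuousLinearMap.adjoint (coordCLM i : Ell2 I E →L[ℂ] E) = inclCLM i := by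
  rw [← adjoint_inclCLM, ContinuousLinearMap.adjoint_adjoint]

/-- The projection of `ℓ²(I, E)` onto the functions supported in the finite set `F`. -/
def truncCLM (F : Finset I) : Ell2 I E →L[ℂ] Ell2 I E :=
  ∑ i : F, inclCLM (i : I) ∘L coordCLM (i : I)

theorem truncCLM_apply [DecidableEq I] (F : Finset I) (φ : Ell2 I E) :
    truncCLM F φ = ∑ i ∈ F, lp.single 2 i (φ i) := by
  rw [truncCLM, _root_.sum_apply, ← Finset.sum_coe_sort F]
  simp [inclCLM_apply]

theorem norm_truncCLM_apply_le (F : Finset I) (φ : Ell2 I E) : ‖truncCLM F φ‖ ≤ ‖φ‖ := by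
  classical
  rw [truncCLM_apply]
  have h := lp.norm_sum_single (E := fun _ : I => E) (p := 2) (by simp) φ F
  have h2 := sum_sq_le_ell2 φ F
  simp only [ENNReal.toReal_ofNat, Real.rpow_ofNat] at h
  rw [← h] at h2
  exact (sq_le_sq₀ (norm_nonneg _) (norm_nonneg _)).1 h2

theorem tendsto_truncCLM (φ : Ell2 I E) :
    Filter.Tendsto (fun F : Finset I => truncCLM F φ) Filter.atTop (nhds φ) := by
  classical
  simp only [truncCLM_apply]
  exact lp.hasSum_single (by simp) φ

/-- The truncations `P_F` converge strongly to the identity, so the norm of an operator is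
controlled by its finite compressions `P_F T P_F`. -/
theorem norm_le_of_norm_trunc_le (T : Ell2 I E →L[ℂ] Ell2 I E) {C : ℝ} (hC : 0 ≤ C)
    (h : ∀ F : Finset I, ‖truncCLM F ∘L T ∘L truncCLM F‖ ≤ C) : ‖T‖ ≤ C := by
  have key : ∀ (φ : Ell2 I E) (F : Finset I), ‖truncCLM F (T (truncCLM F φ))‖ ≤ C * ‖φ‖ :=
    fun φ F => (truncCLM F ∘L T ∘L truncCLM F).le_of_opNorm_le (h F) φ
  refine T.opNorm_le_bound hC fun φ => ?_
  -- The truncations are contractions, so this also holds with a varying truncation in front.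
  have h1 : Filter.Tendsto (fun F : Finset I => truncCLM F (T (truncCLM F φ) - T φ)) Filter.atTop
      (nhds 0) := by
    refine squeeze_zero_norm (fun F => norm_truncCLM_apply_le F _) ?_
    rw [← norm_zero (E := Ell2 I E), ← sub_self (T φ)]
    exact (((T.continuous.tendsto φ).comp (tendsto_truncCLM φ)).sub_const _).norm
  have h2 : Filter.Tendsto (fun F : Finset I => truncCLM F (T (truncCLM F φ))) Filter.atTop
      (nhds (T φ)) := by
    simpa using h1.add (tendsto_truncCLM (T φ))
  exact le_of_tendsto h2.norm (Filter.Eventually.of_forall (key φ))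

theorem norm_trunc_le (T : Ell2 I E →L[ℂ] Ell2 I E) (F : Finset I) :
    ‖truncCLM F ∘L T ∘L truncCLM F‖ ≤ ‖T‖ := by
  refine ContinuousLinearMap.opNorm_le_bound _ (norm_nonneg T) fun φ => ?_
  refine (norm_truncCLM_apply_le F _).trans ((T.le_opNorm _).trans ?_)
  gcongr
  exact norm_truncCLM_apply_le F φ

end Coefficients

/-! ### Amplification of representations to matrix algebras -/

section Matrix

variable {A G H : Type*} [NonUnitalCStarAlgebra A] [NormedAddCommGroup H]
  [InnerProductSpace ℂ H] [CompleteSpace H] (π : A →⋆ₙₐ[ℂ] (H →L[ℂ] H))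

/-- The representation of the matrix algebra `M_F(A)` on `ℓ²(G, H)` for which a matrix acts on the
summand `ℓ²(F, H)` through the entrywise application of `π`, and as zero on its complement. -/
def matrixRep (F : Finset G) : CStarMatrix F F A →⋆ₙₐ[ℂ] (Ell2 G H →L[ℂ] Ell2 G H) where
  toFun M := ∑ g : F, ∑ k : F, inclCLM (g : G) ∘L π (M g k) ∘L coordCLM (k : G)
  map_smul' c M := by
    simp [Finset.smul_sum]
  map_zero' := by simp
  map_add' M N := by
    simp [Finset.sum_add_distrib]
  map_mul' M N := by
    classical
    have h : ∀ g k k' l : F, (inclCLM (g : G) ∘L π (M g k) ∘L coordCLM (k : G)) *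
        (inclCLM (k' : G) ∘L π (N k' l) ∘L coordCLM (l : G)) =
        if k = k' then inclCLM (g : G) ∘L π (M g k * N k' l) ∘L coordCLM (l : G) else 0 := by
      intro g k k' l
      rw [ContinuousLinearMap.mul_def]
      have h1 : (inclCLM (g : G) ∘L π (M g k) ∘L coordCLM (k : G)) ∘L
          (inclCLM (k' : G) ∘L π (N k' l) ∘L coordCLM (l : G)) =
          inclCLM (g : G) ∘L π (M g k) ∘L (coordCLM (k : G) ∘L inclCLM (k' : G)) ∘L
            π (N k' l) ∘L coordCLM (l : G) := rfl
      rw [h1]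
      split_ifs with hk
      · subst hk
        rw [coordCLM_comp_inclCLM_self, map_mul]
        rfl
      · rw [coordCLM_comp_inclCLM_of_ne fun h => hk (Subtype.ext h)]
        simp
    simp only [Finset.sum_mul_sum, h]
    refine Finset.sum_congr rfl fun g _ => ?_
    have h2 : ∀ k : F, ∑ k' : F, ∑ l : F, (if k' = k then
        inclCLM (g : G) ∘L π (M g k' * N k l) ∘L coordCLM (l : G) else 0) =
        ∑ l : F, inclCLM (g : G) ∘L π (M g k * N k l) ∘L coordCLM (l : G) := by
      intro k
      rw [Finset.sum_comm]
      exact Finset.sum_congr rfl fun l _ => by rw [Finset.sum_ite_eq' Finset.univ k]; simp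
    rw [Finset.sum_congr rfl fun k _ => h2 k, Finset.sum_comm]
    refine Finset.sum_congr rfl fun l _ => ?_
    rw [CStarMatrix.mul_apply, map_sum, ContinuousLinearMap.finsetSum_comp,
      ContinuousLinearMap.comp_finsetSum]
  map_star' M := by
    simp only [star_sum, ContinuousLinearMap.star_eq_adjoint, ContinuousLinearMap.adjoint_comp,
      adjoint_inclCLM, adjoint_coordCLM]
    rw [Finset.sum_comm]
    refine Finset.sum_congr rfl fun g _ => Finset.sum_congr rfl fun k _ => ?_
    rw [CStarMatrix.star_apply, map_star, ContinuousLinearMap.star_eq_adjoint,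
      ContinuousLinearMap.comp_assoc]

theorem coordCLM_comp_matrixRep_comp_inclCLM (F : Finset G) (M : CStarMatrix F F A) (g k : F) :
    coordCLM (g : G) ∘L matrixRep π F M ∘L inclCLM (k : G) = π (M g k) := by
  classical
  have h : ∀ g' k' : F, coordCLM (g : G) ∘L
      (inclCLM (g' : G) ∘L π (M g' k') ∘L coordCLM (k' : G)) ∘L inclCLM (k : G) =
      if g' = g then if k' = k then π (M g k) else 0 else 0 := by
    intro g' k'
    have h1 : coordCLM (g : G) ∘L (inclCLM (g' : G) ∘L π (M g' k') ∘L coordCLM (k' : G)) ∘L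
        inclCLM (k : G) = (coordCLM (g : G) ∘L inclCLM (g' : G)) ∘L π (M g' k') ∘L
          (coordCLM (k' : G) ∘L inclCLM (k : G)) := rfl
    rw [h1]
    split_ifs with hg hk
    · subst hg hk
      rw [coordCLM_comp_inclCLM_self, coordCLM_comp_inclCLM_self]
      rfl
    · rw [coordCLM_comp_inclCLM_of_ne fun h => hk (Subtype.ext h)]
      simp
    · rw [coordCLM_comp_inclCLM_of_ne fun h => hg (Subtype.ext h.symm)]
      simp
  change coordCLM (g : G) ∘L (∑ g' : F, ∑ k' : F, _) ∘L _ = _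
  simp only [ContinuousLinearMap.finsetSum_comp, ContinuousLinearMap.comp_finsetSum, h]
  simp

end Matrix

/-! ### The norm of a crossed product does not depend on the faithful representation -/

section Independence

variable {A G H : Type*} [NonUnitalCStarAlgebra A] [Group G] [NormedAddCommGroup H]
  [InnerProductSpace ℂ H] [CompleteSpace H] (α : G →* (A ≃⋆ₐ[ℂ] A)) (π : A →⋆ₙₐ[ℂ] (H →L[ℂ] H))

/-- The matrix `(α_{g⁻¹}(ξ(g k⁻¹)))_{g, k ∈ F}` over `A`, the compression of `ξ ∈ C_c(G, A)` to the
finite set `F`. -/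
def compression (F : Finset G) (ξ : G →₀ A) : CStarMatrix F F A :=
  CStarMatrix.ofMatrix fun g k => α (g : G)⁻¹ (ξ (g * (k : G)⁻¹))

theorem coordCLM_comp_integrated_comp_inclCLM (ξ : G →₀ A) (g k : G) :
    coordCLM g ∘L integrated α π ξ ∘L inclCLM k = π (α g⁻¹ (ξ (g * k⁻¹))) := by
  classical
  ext v
  change integrated α π ξ (inclCLM k v) g = _
  rw [integrated_apply, inclCLM_apply, Finset.sum_eq_single (g * k⁻¹)]
  · simp
  · intro h _ hh
    have : h⁻¹ * g ≠ k := by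
      rintro rfl
      exact hh (by simp)
    simp [this]
  · intro h
    simp [Finsupp.notMem_support_iff.1 h]

theorem trunc_integrated (F : Finset G) (ξ : G →₀ A) :
    truncCLM F ∘L integrated α π ξ ∘L truncCLM F = matrixRep π F (compression α F ξ) := by
  change _ = ∑ g : F, ∑ k : F, inclCLM (g : G) ∘L π (α (g : G)⁻¹ (ξ (g * (k : G)⁻¹))) ∘L
    coordCLM (k : G)
  simp only [truncCLM, ContinuousLinearMap.finsetSum_comp, ContinuousLinearMap.comp_finsetSum,
    ← coordCLM_comp_integrated_comp_inclCLM]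
  rw [Finset.sum_comm]
  rfl

/-- The norm of a regular representation of `C_c(G, A)` is dominated by those of the regular
representations induced by any jointly faithful family. Each finite compression is the image of a
matrix over `A` that does not involve the representation, and a jointly faithful family on `A` is
jointly faithful on matrices over `A`. -/
theorem norm_integrated_le_of_jointly_injective {ι : Type*} {K : ι → Type*}
    [∀ i, NormedAddCommGroup (K i)] [∀ i, InnerProductSpace ℂ (K i)] [∀ i, CompleteSpace (K i)]
    (τ : ∀ i, A →⋆ₙₐ[ℂ] (K i →L[ℂ] K i)) (hτ : ∀ a, (∀ i, τ i a = 0) → a = 0) (ξ : G →₀ A)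
    {C : ℝ} (hC : 0 ≤ C) (h : ∀ i, ‖integrated α (τ i) ξ‖ ≤ C) : ‖integrated α π ξ‖ ≤ C := by
  -- The C*-norm on matrices over `A` is defined in terms of an order on `A`.
  let _ := CStarAlgebra.spectralOrder A
  have _ := CStarAlgebra.spectralOrderedRing A
  refine norm_le_of_norm_trunc_le _ hC fun F => ?_
  rw [trunc_integrated]
  refine (NonUnitalStarAlgHom.norm_apply_le (matrixRep π F) _).trans ?_
  refine norm_le_of_jointly_injective (fun i => matrixRep (τ i) F) (fun M hM => ?_) hC fun i => ?_
  · refine CStarMatrix.ext fun g k => hτ _ fun i => ?_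
    rw [← coordCLM_comp_matrixRep_comp_inclCLM (τ i) F M g k, hM i]
    simp
  · rw [← trunc_integrated]
    exact (norm_trunc_le _ F).trans (h i)

end Independence

/-! ### Isomorphisms given by isometric graphs -/

section Graph

variable {P Q : Type*} [NonUnitalCStarAlgebra P] [NonUnitalCStarAlgebra Q]

theorem norm_fst_eq_norm_snd_of_mem_closure {D : Set (P × Q)} (hD : ∀ T ∈ D, ‖T.1‖ = ‖T.2‖)
    {T : P × Q} (hT : T ∈ closure D) : ‖T.1‖ = ‖T.2‖ :=
  closure_minimal hD (isClosed_eq continuous_fst.norm continuous_snd.norm) hT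

/-- A continuous homomorphism that is isometric on the closure of a subgroup of a complete group
maps that closure onto a closed set. -/
theorem image_closure_eq_of_norm_eq {E F : Type*} [NormedAddCommGroup E] [CompleteSpace E]
    [NormedAddCommGroup F] (f : E →+ F) (hf : Continuous f) (D : AddSubgroup E)
    (hD : ∀ T ∈ closure (D : Set E), ‖f T‖ = ‖T‖) :
    f '' closure (D : Set E) = closure (f '' D) := by
  refine (image_closure_subset_closure_image hf).antisymm
    (closure_minimal (Set.image_mono subset_closure) ?_)
  have h : Isometry fun T : D.topologicalClosure => f T :=
    AddMonoidHomClass.isometry_of_norm (f.comp D.topologicalClosure.subtype) fun T => hD T T.2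
  have : CompleteSpace D.topologicalClosure :=
    D.isClosed_topologicalClosure.completeSpace_coe
  convert h.isClosedEmbedding.isClosed_range
  ext y
  simp only [Set.mem_image, Set.mem_range, Subtype.exists]
  exact ⟨fun ⟨x, hx, hxy⟩ => ⟨x, hx, hxy⟩, fun ⟨x, hx, hxy⟩ => ⟨x, hx, hxy⟩⟩

/-- If a `*`-subalgebra `D` of `P × Q` consists of pairs of elements of the same norm, then its
closure is the graph of an isomorphism between the closures of its two projections. -/
theorem exists_starAlgEquiv_of_norm_eq (D : NonUnitalStarSubalgebra ℂ (P × Q))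
    (hD : ∀ T ∈ D, ‖T.1‖ = ‖T.2‖) (S : NonUnitalStarSubalgebra ℂ P)
    (S' : NonUnitalStarSubalgebra ℂ Q) (hS : (S : Set P) = closure (Prod.fst '' (D : Set (P × Q))))
    (hS' : (S' : Set Q) = closure (Prod.snd '' (D : Set (P × Q)))) :
    ∃ Φ : S ≃⋆ₐ[ℂ] S', ∀ (a : S) (b : S'), Φ a = b ↔ ((a : P), (b : Q)) ∈ D.topologicalClosure := by
  have hcl : (D.topologicalClosure : Set (P × Q)) = closure (D : Set (P × Q)) := rfl
  have hnorm : ∀ T ∈ D.topologicalClosure, ‖T.1‖ = ‖T.2‖ := fun T hT =>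
    norm_fst_eq_norm_snd_of_mem_closure hD hT
  let D' := D.toNonUnitalSubalgebra.toNonUnitalSubring.toAddSubgroup
  have hfst : (S : Set P) = Prod.fst '' closure (D : Set (P × Q)) :=
    hS.trans (image_closure_eq_of_norm_eq (AddMonoidHom.fst P Q) continuous_fst D' fun T hT => by
      rw [Prod.norm_def, ← hnorm T hT, max_self]; rfl).symm
  have hsnd : (S' : Set Q) = Prod.snd '' closure (D : Set (P × Q)) :=
    hS'.trans (image_closure_eq_of_norm_eq (AddMonoidHom.snd P Q) continuous_snd D' fun T hT => by
      rw [Prod.norm_def, hnorm T hT, max_self]; rfl).symm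
  have h1 : ∀ a : S, ∃ b : S', ((a : P), (b : Q)) ∈ D.topologicalClosure := by
    intro a
    obtain ⟨T, hT, hTa⟩ := hfst.subset a.2
    exact ⟨⟨T.2, hsnd.symm.subset ⟨T, hT, rfl⟩⟩, hTa ▸ hT⟩
  have h2 : ∀ b : S', ∃ a : S, ((a : P), (b : Q)) ∈ D.topologicalClosure := by
    intro b
    obtain ⟨T, hT, hTb⟩ := hsnd.subset b.2
    exact ⟨⟨T.1, hfst.symm.subset ⟨T, hT, rfl⟩⟩, hTb ▸ hT⟩
  have h3 : ∀ {a : P} {b b' : Q}, (a, b) ∈ D.topologicalClosure → (a, b') ∈ D.topologicalClosure →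
      b = b' := by
    intro a b b' h h'
    have := hnorm _ (sub_mem h h')
    simpa [sub_eq_zero, eq_comm] using this
  have h4 : ∀ {a a' : P} {b : Q}, (a, b) ∈ D.topologicalClosure → (a', b) ∈ D.topologicalClosure →
      a = a' := by
    intro a a' b h h'
    have := hnorm _ (sub_mem h h')
    simpa [sub_eq_zero] using this
  choose F hF using h1
  choose F' hF' using h2
  refine ⟨{ toFun := F, invFun := F', left_inv := ?_, right_inv := ?_, map_mul' := ?_,
            map_add' := ?_, map_star' := ?_, map_smul' := ?_ }, fun a b => ⟨?_, fun h => ?_⟩⟩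
  · exact fun a => Subtype.ext (h4 (hF' (F a)) (hF a))
  · exact fun b => Subtype.ext (h3 (hF (F' b)) (hF' b))
  · exact fun a b => Subtype.ext (h3 (hF (a * b)) (mul_mem (hF a) (hF b)))
  · exact fun a b => Subtype.ext (h3 (hF (a + b)) (add_mem (hF a) (hF b)))
  · exact fun a => Subtype.ext (h3 (hF (star a)) (star_mem (hF a)))
  · exact fun c a => Subtype.ext (h3 (hF (c • a)) (SMulMemClass.smul_mem c (hF a)))
  · rintro rfl
    exact hF a
  · exact Subtype.ext (h3 (hF a) h)

end Graph

/-! ### Currying square summable functions -/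

section Curry

variable {I J E : Type*} [NormedAddCommGroup E] [InnerProductSpace ℂ E]

/-- The function `φ(i, ·)` on `J`, for `φ ∈ ℓ²(I × J, E)`. -/
def sliceEll2 (φ : Ell2 (I × J) E) (i : I) : Ell2 J E :=
  ⟨fun j => φ (i, j), memEll2_of_sum_sq_le _ (‖φ‖ ^ 2) fun s => by
    simpa using sum_sq_le_ell2 φ (s.map ⟨Prod.mk i, Prod.mk_right_injective i⟩)⟩

theorem hasSum_norm_sq {I E : Type*} [NormedAddCommGroup E] (φ : Ell2 I E) :
    HasSum (fun i => ‖φ i‖ ^ 2) (‖φ‖ ^ 2) := by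
  simpa using lp.hasSum_norm (p := 2) (by simp) φ

theorem hasSum_norm_sliceEll2 (φ : Ell2 (I × J) E) :
    HasSum (fun i => ‖sliceEll2 φ i‖ ^ 2) (‖φ‖ ^ 2) :=
  (hasSum_norm_sq φ).prod_fiberwise fun i => hasSum_norm_sq (sliceEll2 φ i)

/-- The unitary `ℓ²(I × J, E) → ℓ²(I, ℓ²(J, E))`. -/
def curryU : Ell2 (I × J) E ≃ₗᵢ[ℂ] Ell2 I (Ell2 J E) where
  toFun φ := ⟨sliceEll2 φ, memEll2_of_sum_sq_le _ (‖φ‖ ^ 2) fun s =>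
    sum_le_hasSum s (fun _ _ => by positivity) (hasSum_norm_sliceEll2 φ)⟩
  invFun ψ := ⟨fun x => ψ x.1 x.2, by
    refine (memℓp_gen_iff (by simp)).2 ?_
    simp only [ENNReal.toReal_ofNat, Real.rpow_ofNat]
    refine (summable_prod_of_nonneg fun _ => by positivity).2
      ⟨fun i => (hasSum_norm_sq (ψ i)).summable, ?_⟩
    simp only [(hasSum_norm_sq (ψ _)).tsum_eq]
    exact (hasSum_norm_sq ψ).summable⟩
  left_inv φ := rfl
  right_inv ψ := rfl
  map_add' φ ψ := rfl
  map_smul' c φ := rfl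
  norm_map' φ := by
    refine (sq_eq_sq₀ (norm_nonneg _) (norm_nonneg _)).1 ?_
    exact (hasSum_norm_sq _).unique (hasSum_norm_sliceEll2 φ)

end Curry

/-! ### Norm estimates for regular representations of crossed products -/

section Bound

variable {A G H : Type*} [NonUnitalCStarAlgebra A] [Group G] [NormedAddCommGroup H]
  [InnerProductSpace ℂ H] [CompleteSpace H] (α : G →* (A ≃⋆ₐ[ℂ] A)) (π : A →⋆ₙₐ[ℂ] (H →L[ℂ] H))

theorem norm_diagOp_le {I E : Type*} [NormedAddCommGroup E] [InnerProductSpace ℂ E]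
    (T : I → E →L[ℂ] E) (C : ℝ) (hC : 0 ≤ C) (hT : ∀ i, ‖T i‖ ≤ C) : ‖diagOp T C hC hT‖ ≤ C := by
  unfold diagOp
  exact LinearMap.mkContinuous_norm_le _ hC _

theorem norm_covOp_le (h : G) (a : A) : ‖covOp α π h a‖ ≤ ‖a‖ := by
  refine ContinuousLinearMap.opNorm_le_bound _ (norm_nonneg a) fun φ => ?_
  have hT : ∀ g : G, ‖π (α g⁻¹ a)‖ ≤ ‖a‖ := fun g =>
    (NonUnitalStarAlgHom.norm_apply_le π _).trans (StarAlgEquiv.norm_map _ a).le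
  refine (ContinuousLinearMap.le_of_opNorm_le _ (norm_diagOp_le _ _ (norm_nonneg a) hT)
    (reindexU (Equiv.mulLeft h) φ)).trans_eq ?_
  rw [LinearIsometryEquiv.norm_map]

theorem norm_integrated_le (ξ : G →₀ A) : ‖integrated α π ξ‖ ≤ ∑ h ∈ ξ.support, ‖ξ h‖ :=
  (norm_sum_le _ _).trans (Finset.sum_le_sum fun h _ => norm_covOp_le α π h (ξ h))

end Bound

/-! ### Auxiliary facts on representations and dual actions -/

theorem continuous_starHom {A B : Type*} [NonUnitalCStarAlgebra A] [NonUnitalCStarAlgebra B]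
    (φ : A →⋆ₙₐ[ℂ] B) : Continuous φ :=
  AddMonoidHomClass.continuous_of_bound φ 1 fun a => by
    rw [one_mul]
    exact NonUnitalStarAlgHom.norm_apply_le φ a

theorem continuous_conjStarAlgEquiv {E : Type*} [NormedAddCommGroup E] [InnerProductSpace ℂ E]
    [CompleteSpace E] (U : E ≃ₗᵢ[ℂ] E) : Continuous U.conjStarAlgEquiv :=
  (StarAlgEquiv.isometry U.conjStarAlgEquiv).continuous

/-- The `u`-th regular representation of `C_r^*(𝒢)`, on `ℓ²(𝒢_u)`. -/
def EtaleGroupoid.regularRep {X Γ : Type*} [TopologicalSpace X] [TopologicalSpace Γ]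
    (𝒢 : EtaleGroupoid X Γ) (u : X) :
    𝒢.reducedCStar →⋆ₙₐ[ℂ] (Ell2 (𝒢.Fiber u) ℂ →L[ℂ] Ell2 (𝒢.Fiber u) ℂ) where
  toFun a := (a : 𝒢.Families) u
  map_smul' _ _ := rfl
  map_zero' := rfl
  map_add' _ _ := rfl
  map_mul' _ _ := rfl
  map_star' _ := rfl

theorem EtaleGroupoid.IsCocycle.coe_dualAction {X Γ G : Type*} [TopologicalSpace X]
    [TopologicalSpace Γ] {𝒢 : EtaleGroupoid X Γ} [Group G] [TopologicalSpace G] {ρ : Γ → G}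
    (hρ : 𝒢.IsCocycle ρ) (χ : PontryaginDual G) (a : 𝒢.reducedCStar) :
    ((hρ.dualAction χ a : 𝒢.reducedCStar) : 𝒢.Families) = hρ.phaseHom χ a := rfl

theorem coe_crossedDualAction {A G H : Type*} [NonUnitalCStarAlgebra A] [Group G]
    [NormedAddCommGroup H] [InnerProductSpace ℂ H] [CompleteSpace H] [TopologicalSpace G]
    (α : G →* (A ≃⋆ₐ[ℂ] A)) (π : A →⋆ₙₐ[ℂ] (H →L[ℂ] H)) (χ : PontryaginDual G)
    (b : reducedCrossedProduct α π) :
    ((crossedDualAction α π χ b : reducedCrossedProduct α π) : Ell2 G H →L[ℂ] Ell2 G H) =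
      crossedPhase (H := H) χ (b : Ell2 G H →L[ℂ] Ell2 G H) := rfl

/-! ### Families of operators over the semi-direct product groupoid -/

section Semidirect

variable {X : Type*} [TopologicalSpace X] [CompactSpace X] [T2Space X] (R : Setoid X)
  [TopologicalSpace (RelArrow R)] [IsEtaleRel R] (G : Type*) [Group G] [TopologicalSpace G]
  [DiscreteTopology G] [Countable G] [MulAction G X] [IsAutSystem G R]

/-- The bijection `(x, g, u) ↦ (g, (g⁻¹ x, u))` from `(R ⋊_α G)_u` to `G × R_u`. -/
def semiFiberEquiv (u : X) :
    (semidirectGroupoid R G).Fiber u ≃ G × (relGroupoid R).Fiber u where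
  toFun γ := (γ.1.grp, ⟨⟨γ.1.grp⁻¹ • γ.1.fst, γ.1.snd, by
    have := IsAutSystem.smul_rel (R := R) γ.1.grp⁻¹ γ.1.rel
    rwa [inv_smul_smul] at this⟩, γ.2⟩)
  invFun p := ⟨⟨p.1 • p.2.1.fst, p.1, p.2.1.snd, IsAutSystem.smul_rel p.1 p.2.1.rel⟩, p.2.2⟩
  left_inv γ := Subtype.ext (SemiArrow.ext (smul_inv_smul _ _) rfl rfl)
  right_inv p := Prod.ext rfl (Subtype.ext (RelArrow.ext (inv_smul_smul _ _) rfl))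

/-- The unitary `ℓ²((R ⋊_α G)_u) → ℓ²(G, ℓ²(R_u))` induced by `(x, g, u) ↦ (g, (g⁻¹ x, u))`. -/
def semiU (u : X) :
    Ell2 ((semidirectGroupoid R G).Fiber u) ℂ ≃ₗᵢ[ℂ] Ell2 G (Ell2 ((relGroupoid R).Fiber u) ℂ) :=
  (reindexU (semiFiberEquiv R G u)).trans curryU

theorem semiU_apply (u : X) (φ : Ell2 ((semidirectGroupoid R G).Fiber u) ℂ) (g : G)
    (β : (relGroupoid R).Fiber u) : semiU R G u φ g β = φ ((semiFiberEquiv R G u).symm (g, β)) :=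
  rfl

theorem semiU_symm_apply (u : X) (ψ : Ell2 G (Ell2 ((relGroupoid R).Fiber u) ℂ))
    (γ : (semidirectGroupoid R G).Fiber u) :
    (semiU R G u).symm ψ γ = ψ γ.1.grp (semiFiberEquiv R G u γ).2 := rfl

/-- The representation of `C_c(G, C_r^*(R))` by families of operators on the spaces
`ℓ²((R ⋊_α G)_u)`: the regular representation induced by the `u`-th regular representation of
`C_r^*(R)`, transported along the unitary `ℓ²((R ⋊_α G)_u) ≅ ℓ²(G, ℓ²(R_u))`. -/
def crossedFamily (ξ : G →₀ (relGroupoid R).reducedCStar) : (semidirectGroupoid R G).Families :=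
  ⟨fun u => (semiU R G u).symm.conjStarAlgEquiv
      (integrated (relAction R G) ((relGroupoid R).regularRep u) ξ),
    memℓp_infty ⟨∑ h ∈ ξ.support, ‖ξ h‖, by
      rintro _ ⟨u, rfl⟩
      exact (StarAlgEquiv.norm_map _ _).trans_le (norm_integrated_le _ _ ξ)⟩⟩

theorem crossedFamily_apply (ξ : G →₀ (relGroupoid R).reducedCStar) (u : X) :
    crossedFamily R G ξ u = (semiU R G u).symm.conjStarAlgEquiv
      (integrated (relAction R G) ((relGroupoid R).regularRep u) ξ) := rfl

theorem crossedFamily_add (ξ η : G →₀ (relGroupoid R).reducedCStar) :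
    crossedFamily R G (ξ + η) = crossedFamily R G ξ + crossedFamily R G η :=
  EtaleGroupoid.families_ext_apply fun u => by
    rw [crossedFamily_apply, integrated_add]
    exact (semiU R G u).symm.conjStarAlgEquiv.map_add' _ _

theorem crossedFamily_zero : crossedFamily R G 0 = 0 :=
  EtaleGroupoid.families_ext_apply fun u => by
    rw [crossedFamily_apply, integrated_zero, map_zero]
    rfl

theorem crossedFamily_smul (c : ℂ) (ξ : G →₀ (relGroupoid R).reducedCStar) :
    crossedFamily R G (c • ξ) = c • crossedFamily R G ξ :=
  EtaleGroupoid.families_ext_apply fun u => by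
    rw [crossedFamily_apply, integrated_smul]
    exact (semiU R G u).symm.conjStarAlgEquiv.map_smul' _ _

theorem crossedFamily_twistedConv (ξ η : G →₀ (relGroupoid R).reducedCStar) :
    crossedFamily R G (twistedConv (relAction R G) ξ η) =
      crossedFamily R G ξ * crossedFamily R G η :=
  EtaleGroupoid.families_ext_apply fun u => by
    rw [crossedFamily_apply, integrated_twistedConv, map_mul]
    rfl

theorem crossedFamily_twistedStar (ξ : G →₀ (relGroupoid R).reducedCStar) :
    crossedFamily R G (twistedStar (relAction R G) ξ) = star (crossedFamily R G ξ) :=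
  EtaleGroupoid.families_ext_apply fun u => by
    rw [crossedFamily_apply, integrated_twistedStar, map_star]
    rfl

theorem crossedFamily_sum {ι : Type*} (s : Finset ι)
    (ξ : ι → G →₀ (relGroupoid R).reducedCStar) :
    crossedFamily R G (∑ i ∈ s, ξ i) = ∑ i ∈ s, crossedFamily R G (ξ i) :=
  map_sum (AddMonoidHom.mk' (crossedFamily R G) (crossedFamily_add R G)) ξ s

theorem norm_crossedFamily_apply (ξ : G →₀ (relGroupoid R).reducedCStar) (u : X) :
    ‖crossedFamily R G ξ u‖ =
      ‖integrated (relAction R G) ((relGroupoid R).regularRep u) ξ‖ :=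
  StarAlgEquiv.norm_map _ _

/-- The norm of an element of `C_c(G, C_r^*(R))` in the crossed product formed with a faithful `π`
is the norm of the associated family: `π` alone and the regular representations of `C_r^*(R)` together
are both jointly faithful. -/
theorem norm_crossedFamily {H : Type*} [NormedAddCommGroup H] [InnerProductSpace ℂ H]
    [CompleteSpace H] (π : (relGroupoid R).reducedCStar →⋆ₙₐ[ℂ] (H →L[ℂ] H))
    (hπ : Function.Injective π) (ξ : G →₀ (relGroupoid R).reducedCStar) :
    ‖crossedFamily R G ξ‖ = ‖integrated (relAction R G) π ξ‖ := by
  refine le_antisymm ?_ ?_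
  · refine lp.norm_le_of_forall_le (norm_nonneg _) fun u => ?_
    refine (norm_crossedFamily_apply R G ξ u).trans_le ?_
    exact norm_integrated_le_of_jointly_injective _ _ (fun _ : Unit => π)
      (fun a ha => (injective_iff_map_eq_zero π).1 hπ a (ha ())) ξ (norm_nonneg _)
      fun _ => le_rfl
  · refine norm_integrated_le_of_jointly_injective _ _ (relGroupoid R).regularRep
      (fun a ha => Subtype.ext (EtaleGroupoid.families_ext_apply ha)) ξ (norm_nonneg _) fun u => ?_
    rw [← norm_crossedFamily_apply]
    exact EtaleGroupoid.norm_families_apply_le _ u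

theorem norm_crossedFamily_single_le (h : G) (a : (relGroupoid R).reducedCStar) :
    ‖crossedFamily R G (Finsupp.single h a)‖ ≤ ‖a‖ := by
  refine lp.norm_le_of_forall_le (norm_nonneg _) fun u => ?_
  refine (norm_crossedFamily_apply R G _ u).trans_le ?_
  rw [integrated_single]
  exact norm_covOp_le _ _ h a

/-! ### Functions on `R ⋊_α G` supported over one element of `G` -/

variable {R G}

open Classical in
/-- The function on `R ⋊_α G` that is `f` on the copy `R × {h}` of `R` and zero elsewhere, where
`R ⋊_α G` is identified with `R × G` by `(x, g, y) ↦ ((x, g y), g)`. -/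
def liftCc (h : G) (f : C_c(RelArrow R, ℂ)) : C_c(SemiArrow R G, ℂ) where
  toFun γ := if γ.grp = h then f γ.toProd.1 else 0
  continuous_toFun := by
    have h1 := SemiArrow.continuous_toProd R G
    have h2 : Continuous fun γ : SemiArrow R G =>
        f γ.toProd.1 * (if γ.toProd.2 = h then 1 else 0) :=
      (f.continuous.comp (continuous_fst.comp h1)).mul
        ((continuous_of_discreteTopology (f := fun g : G => if g = h then (1 : ℂ) else 0)).comp
          (continuous_snd.comp h1))
    refine h2.congr fun γ => ?_
    rw [mul_ite, mul_one, mul_zero]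
    rfl
  hasCompactSupport' := by
    have := (semidirectGroupoid R G).t2Space
    refine HasCompactSupport.intro ((f.hasCompactSupport.isCompact.prod
      (isCompact_singleton (x := h))).image SemiArrow.homeoProd.symm.continuous) fun γ hγ => ?_
    by_contra hne
    refine hγ ⟨γ.toProd, ⟨?_, ?_⟩, SemiArrow.homeoProd.symm_apply_apply γ⟩
    · refine subset_tsupport f fun h0 => hne ?_
      simp [h0]
    · by_contra h0
      exact hne (if_neg h0)

/-- The restriction of a function on `R ⋊_α G` to the copy `R × {h}` of `R`. -/
def sliceCc (h : G) (f : C_c(SemiArrow R G, ℂ)) : C_c(RelArrow R, ℂ) where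
  toFun a := f (SemiArrow.homeoProd.symm (a, h))
  continuous_toFun := f.continuous.comp
    (SemiArrow.homeoProd.symm.continuous.comp (continuous_id.prodMk continuous_const))
  hasCompactSupport' := by
    have := (relGroupoid R).t2Space
    refine HasCompactSupport.intro (f.hasCompactSupport.isCompact.image
      (continuous_fst.comp (SemiArrow.continuous_toProd R G))) fun a ha => ?_
    by_contra hne
    refine ha ⟨_, subset_tsupport f hne, ?_⟩
    exact congrArg Prod.fst (SemiArrow.homeoProd.apply_symm_apply (a, h))

/-- A compactly supported function on `R ⋊_α G` lives over finitely many elements of `G`. -/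
theorem exists_sum_liftCc (f : C_c(SemiArrow R G, ℂ)) :
    ∃ s : Finset G, f = ∑ h ∈ s, liftCc h (sliceCc h f) := by
  classical
  have hfin : (SemiArrow.grp '' tsupport f).Finite :=
    (f.hasCompactSupport.isCompact.image (semidirect_isCocycle R G).continuous).finite_of_discrete
  refine ⟨hfin.toFinset, ?_⟩
  ext γ
  rw [CompactlySupportedContinuousMap.sum_apply]
  have h1 : ∀ h, liftCc h (sliceCc h f) γ = if γ.grp = h then f γ else 0 := by
    intro h
    change (if γ.grp = h then f (SemiArrow.homeoProd.symm (γ.toProd.1, h)) else 0) = _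
    split_ifs with hh
    · subst hh
      exact congrArg f (SemiArrow.homeoProd.symm_apply_apply γ)
    · rfl
  simp only [h1]
  rw [Finset.sum_ite_eq]
  split_ifs with h2
  · rfl
  · by_contra hne
    exact h2 (hfin.mem_toFinset.2 ⟨γ, subset_tsupport f hne, rfl⟩)

/-- The element of `C_r^*(R)` given by `f ∈ C_c(R)`. -/
def ccElem (f : C_c(RelArrow R, ℂ)) : (relGroupoid R).reducedCStar :=
  ⟨(relGroupoid R).regular f, subset_closure ⟨f, rfl⟩⟩

/-- For `f ∈ C_c(R)`, the element `f δ_h` of `C_c(G, C_r^*(R))` and the function on `R ⋊_α G` that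
is `f` over `h` give the same family of operators. -/
theorem crossedFamily_single_ccElem (h : G) (f : C_c(RelArrow R, ℂ)) :
    crossedFamily R G (Finsupp.single h (ccElem f)) =
      (semidirectGroupoid R G).regular (liftCc h f) := by
  classical
  refine EtaleGroupoid.families_ext_apply fun u => ?_
  ext φ γ
  obtain ⟨⟨g, β⟩, rfl⟩ := (semiFiberEquiv R G u).symm.surjective γ
  rw [crossedFamily_apply, LinearIsometryEquiv.conjStarAlgEquiv_apply_apply, semiU_symm_apply,
    Equiv.apply_symm_apply, integrated_single]
  change (((relGroupoid R).regularRep u) (relAction R G g⁻¹ (ccElem f))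
    (semiU R G u φ (h⁻¹ * g))) β = (semidirectGroupoid R G).Ind u (liftCc h f) φ _
  have h1 : ((relGroupoid R).regularRep u) (relAction R G g⁻¹ (ccElem f)) =
      (relGroupoid R).Ind u ((relGroupoid_isActionByAut R G).translate g⁻¹ f) :=
    congrArg (fun T : (relGroupoid R).Families => T u)
      ((relGroupoid_isActionByAut R G).conjHom_regular g⁻¹ f)
  rw [h1, EtaleGroupoid.Ind_apply, EtaleGroupoid.Ind_apply]
  -- Only the arrows `γ'` over `h⁻¹ g` contribute to the right-hand side.
  let j : (relGroupoid R).Fiber u → (semidirectGroupoid R G).Fiber u := fun β' =>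
    (semiFiberEquiv R G u).symm (h⁻¹ * g, β')
  have hj : Function.Injective j := fun a b hab =>
    congrArg Prod.snd ((semiFiberEquiv R G u).symm.injective hab)
  rw [← hj.tsum_eq]
  · refine tsum_congr fun β' => ?_
    rw [semiU_apply]
    congr 1
    refine Eq.trans ?_ (if_pos (show g * (h⁻¹ * g)⁻¹ = h by simp)).symm
    refine congrArg f (RelArrow.ext ?_ ?_)
    · exact congrArg (· • β.1.fst) (inv_inv g)
    · change g⁻¹⁻¹ • β'.1.fst = (g * (h⁻¹ * g)⁻¹) • (h⁻¹ * g) • β'.1.fst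
      rw [smul_smul, inv_mul_cancel_right, inv_inv]
  · intro γ' hγ'
    obtain ⟨⟨g', β'⟩, rfl⟩ := (semiFiberEquiv R G u).symm.surjective γ'
    have hne := left_ne_zero_of_mul hγ'
    have h2 : g * g'⁻¹ = h := by
      by_contra h0
      exact hne (if_neg h0)
    refine ⟨β', ?_⟩
    simp only [j, ← h2]
    simp

theorem range_regular_subset_range_crossedFamily :
    Set.range (semidirectGroupoid R G).regular ⊆ Set.range (crossedFamily R G) := by
  rintro _ ⟨f, rfl⟩
  obtain ⟨s, hs⟩ := exists_sum_liftCc f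
  refine ⟨∑ h ∈ s, Finsupp.single h (ccElem (sliceCc h f)), ?_⟩
  rw [crossedFamily_sum]
  simp only [crossedFamily_single_ccElem]
  conv_rhs => rw [hs]
  exact (map_sum (AddMonoidHom.mk' (semidirectGroupoid R G).regular
    (semidirectGroupoid R G).regular_add) _ s).symm

theorem crossedFamily_mem_reducedCStar (ξ : G →₀ (relGroupoid R).reducedCStar) :
    crossedFamily R G ξ ∈ (semidirectGroupoid R G).reducedCStar := by
  induction ξ using Finsupp.induction_linear with
  | zero => rw [crossedFamily_zero]; exact zero_mem _
  | add ξ η hξ hη => rw [crossedFamily_add]; exact add_mem hξ hη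
  | single h a =>
    refine Metric.mem_closure_iff.2 fun ε hε => ?_
    obtain ⟨_, ⟨f, rfl⟩, hf⟩ := Metric.mem_closure_iff.1 a.2 ε hε
    refine ⟨_, ⟨liftCc h f, rfl⟩, ?_⟩
    rw [← crossedFamily_single_ccElem, dist_eq_norm]
    have h1 : crossedFamily R G (Finsupp.single h a) -
        crossedFamily R G (Finsupp.single h (ccElem f)) =
        crossedFamily R G (Finsupp.single h (a - ccElem f)) := by
      rw [Finsupp.single_sub]
      exact (map_sub (AddMonoidHom.mk' (crossedFamily R G) (crossedFamily_add R G)) _ _).symm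
    rw [h1]
    refine (norm_crossedFamily_single_le R G h _).trans_lt ?_
    rw [dist_eq_norm] at hf
    exact hf

/-- Functions on `R ⋊_α G` are finite sums of elements `f δ_h` with `f ∈ C_c(R)`, and these are dense
among the elements `a δ_h` with `a ∈ C_r^*(R)`. -/
theorem closure_range_crossedFamily :
    closure (Set.range (crossedFamily R G)) =
      ((semidirectGroupoid R G).reducedCStar : Set (semidirectGroupoid R G).Families) :=
  (closure_minimal (Set.range_subset_iff.2 crossedFamily_mem_reducedCStar)
    (NonUnitalStarSubalgebra.isClosed_topologicalClosure _)).antisymm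
    (closure_mono range_regular_subset_range_crossedFamily)

/-! ### The graph of the isomorphism, and the dual actions -/

section Isomorphism

variable {H : Type*} [NormedAddCommGroup H] [InnerProductSpace ℂ H] [CompleteSpace H]
  (π : (relGroupoid R).reducedCStar →⋆ₙₐ[ℂ] (H →L[ℂ] H))

variable (G) in
/-- The `*`-algebra of all pairs consisting of the two realizations of an element of
`C_c(G, C_r^*(R))`: on the spaces `ℓ²((R ⋊_α G)_u)`, and on `ℓ²(G, H)`. -/
def crossedGraph :
    NonUnitalStarSubalgebra ℂ ((semidirectGroupoid R G).Families × (Ell2 G H →L[ℂ] Ell2 G H)) where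
  carrier := Set.range fun ξ => (crossedFamily R G ξ, integrated (relAction R G) π ξ)
  add_mem' := by
    rintro _ _ ⟨ξ, rfl⟩ ⟨η, rfl⟩
    exact ⟨ξ + η, Prod.ext (crossedFamily_add R G ξ η) (integrated_add _ π ξ η)⟩
  zero_mem' := ⟨0, Prod.ext (crossedFamily_zero R G) (integrated_zero (relAction R G) π)⟩
  mul_mem' := by
    rintro _ _ ⟨ξ, rfl⟩ ⟨η, rfl⟩
    exact ⟨twistedConv (relAction R G) ξ η,
      Prod.ext (crossedFamily_twistedConv R G ξ η) (integrated_twistedConv _ π ξ η)⟩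
  smul_mem' := by
    rintro c _ ⟨ξ, rfl⟩
    exact ⟨c • ξ, Prod.ext (crossedFamily_smul R G c ξ) (integrated_smul _ π c ξ)⟩
  star_mem' := by
    rintro _ ⟨ξ, rfl⟩
    exact ⟨twistedStar (relAction R G) ξ,
      Prod.ext (crossedFamily_twistedStar R G ξ) (integrated_twistedStar _ π ξ)⟩

theorem coe_crossedGraph : (crossedGraph G π : Set _) =
    Set.range fun ξ => (crossedFamily R G ξ, integrated (relAction R G) π ξ) := rfl

theorem exists_starAlgEquiv_graph (hπ : Function.Injective π) :
    ∃ Φ : (semidirectGroupoid R G).reducedCStar ≃⋆ₐ[ℂ] reducedCrossedProduct (relAction R G) π,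
      ∀ a b, Φ a = b ↔ ((a : (semidirectGroupoid R G).Families), (b : Ell2 G H →L[ℂ] Ell2 G H)) ∈
        (crossedGraph G π).topologicalClosure := by
  refine exists_starAlgEquiv_of_norm_eq (crossedGraph G π) ?_ _ _ ?_ ?_
  · rintro _ ⟨ξ, rfl⟩
    exact norm_crossedFamily R G π hπ ξ
  · rw [← closure_range_crossedFamily, coe_crossedGraph, ← Set.range_comp]
    rfl
  · rw [coe_crossedGraph, ← Set.range_comp]
    rfl

theorem phaseHom_crossedFamily (χ : PontryaginDual G) (ξ : G →₀ (relGroupoid R).reducedCStar) :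
    (semidirect_isCocycle R G).phaseHom χ (crossedFamily R G ξ) =
      crossedFamily R G (crossedTwist χ ξ) := by
  refine EtaleGroupoid.families_ext_apply fun u => ?_
  rw [crossedFamily_apply, ← crossedPhase_integrated]
  rfl

/-- The graph of the isomorphism is invariant under the two dual actions. -/
theorem phase_mem_closure_crossedGraph (χ : PontryaginDual G)
    {a : (semidirectGroupoid R G).Families} {b : Ell2 G H →L[ℂ] Ell2 G H}
    (hab : (a, b) ∈ (crossedGraph G π).topologicalClosure) :
    ((semidirect_isCocycle R G).phaseHom χ a, crossedPhase (H := H) χ b) ∈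
      (crossedGraph G π).topologicalClosure := by
  have h1 : Continuous ((semidirect_isCocycle R G).phaseHom χ) :=
    continuous_starHom _
  have h2 : Continuous (crossedPhase (G := G) (H := H) χ) := continuous_conjStarAlgEquiv _
  have h3 := (h1.comp (continuous_fst (Y := Ell2 G H →L[ℂ] Ell2 G H))).prodMk
    (h2.comp (continuous_snd (X := (semidirectGroupoid R G).Families)))
  refine map_mem_closure (t := (crossedGraph G π : Set _)) h3 hab ?_
  rintro _ ⟨ξ, rfl⟩
  exact ⟨crossedTwist χ ξ, Prod.ext (phaseHom_crossedFamily χ ξ).symm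
    (crossedPhase_integrated _ π χ ξ).symm⟩

set_option maxHeartbeats 800000 in
theorem exists_starAlgEquiv_dualAction (hπ : Function.Injective π) :
    ∃ Φ : (semidirectGroupoid R G).reducedCStar ≃⋆ₐ[ℂ] reducedCrossedProduct (relAction R G) π,
      ∀ (χ : PontryaginDual G) (a : (semidirectGroupoid R G).reducedCStar),
        Φ ((semidirect_isCocycle R G).dualAction χ a) =
          crossedDualAction (relAction R G) π χ (Φ a) := by
  obtain ⟨Φ, hΦ⟩ := exists_starAlgEquiv_graph (G := G) π hπ
  refine ⟨Φ, fun χ a => ?_⟩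
  rw [hΦ, EtaleGroupoid.IsCocycle.coe_dualAction, coe_crossedDualAction]
  have ha : Φ a = Φ a := rfl
  have hmem := (hΦ a (Φ a)).1 ha
  have hphase := phase_mem_closure_crossedGraph π χ hmem
  exact hphase

end Isomorphism

end Semidirect

end

end EtaleCrossed

theorem theorem3p5 {X : Type*} [TopologicalSpace X] [CompactSpace X]
    [TopologicalSpace.MetrizableSpace X]
    {G : Type*} [Group G] [Countable G] [TopologicalSpace G] [DiscreteTopology G] [MulAction G X]
    (R : Setoid X) [TopologicalSpace (RelArrow R)] [IsEtaleRel R] [IsAutSystem G R]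
    {H : Type*} [NormedAddCommGroup H] [InnerProductSpace ℂ H] [CompleteSpace H]
    (π : (relGroupoid R).reducedCStar →⋆ₙₐ[ℂ] (H →L[ℂ] H)) (hπ : Function.Injective π) :
    ∃ Φ : (semidirectGroupoid R G).reducedCStar ≃⋆ₐ[ℂ] reducedCrossedProduct (relAction R G) π,
      (∀ g h : G, g * h = h * g) →
        ∀ (χ : PontryaginDual G) (a : (semidirectGroupoid R G).reducedCStar),
          Φ ((semidirect_isCocycle R G).dualAction χ a) =
            crossedDualAction (relAction R G) π χ (Φ a) := by
  obtain ⟨Φ, hΦ⟩ := exists_starAlgEquiv_dualAction (G := G) π hπ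
  exact ⟨Φ, fun _ => hΦ⟩
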